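/- **Setting.** Let $X,Y$ be Banach spaces over $\mathbb R$ or $\mathbb C$, let $A,B$ be closed linear operators from $X$ to $Y$ with domains $D_A\subseteq D_B$, where $D:=D_A\neq\{0\}$ is dense in $X$ and $\operatorname{range}(A)$ is closed; $D$ carries the norm of $X$. Let $\mathbb R_+=[0,\infty)$ and $f\in C(\mathbb R_+\times D,Y)$. Consider $$\frac{d}{dt}[Ax]+Bx=f(t,x),\qquad x(t_0)=x_0. \tag{1}$$ A solution of the equation on an interval $J\subseteq\mathbb R_+$ is a function $x\in C(J,X)$ with $x(t)\in D$ and $Ax\in C^1(J,Y)$ that satisfies the equation on $J$ (if $J=\mathbb R_+$: $Ax\in C^1((0,\infty),Y)$ and the equation holds on $(0,\infty)$). Suppose that $\lambda A+B$ is a regular pencil of index $\nu$: for all complex $\mu\ne0$ near $0$ the operator $A+\mu B:D\to Y$ (its complexification, if the spaces are real) has an inverse in $\mathcal L(Y,X)$, and $\nu$ is the least integer $\ge 0$ with $\|(A+\mu B)^{-1}\|\le C|\mu|^{-\nu}$ near $\mu=0$. Let $\dim\ker A=n<\infty$. Let $\{\varphi_i^j\}$, $i=1,\dots,n$, $j=1,\dots,m_i$,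 $m_i\geq 1$, $\max_i m_i=\nu$, be a canonical system of eigenvectors and adjoined vectors: $\{\varphi_i^1\}$ is a basis of $\ker A$ and $A\varphi_i^j=-B\varphi_i^{j-1}$ for $j\ge2$; and let $q_i^j\in Y^*$ be such that $\langle B\varphi_i^j,q_k^l\rangle=\delta_{ik}\delta_{jl}$, and, for $x\in D$, $\langle Ax,q_i^{m_i}\rangle=0$ and $\langle Ax,q_i^j\rangle=-\langle Bx,q_i^{j+1}\rangle$ for $j<m_i$. For $x\in D$, $y\in Y$ put $$P_{20}x=\sum_i\langle Bx,q_i^1\rangle\varphi_i^1,\quad P_{2\Sigma}x=\sum_i\sum_{j=2}^{m_i}\langle Bx,q_i^j\rangle\varphi_i^j,\quad P_1=I-P_{2\Sigma}-P_{20},$$ $$Q_{2*}y=\sum_i\langle y,q_i^{m_i}\rangle B\varphi_i^{m_i},\quad Q_{2\Sigma}y=\sum_i\sum_{j=1}^{m_i-1}\langle y,q_i^j\rangle B\varphi_i^j,\quad Q_1=I-Q_{2\Sigma}-Q_{2*}.$$ Denote $x_1=P_1x$, $x_{2\Sigma}=P_{2\Sigma}x$, $x_{20}=P_{20}x$, let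 $D_1,D_{2\Sigma},D_{20}=\ker A$ and $Y_1,Y_{2\Sigma},Y_{2*}$ be the ranges of these projectors, and let $W=Y_1\dotplus Y_{2\Sigma}$. The operator $\widetilde A x=Ax+\sum_i\langle Bx,q_i^1\rangle B\varphi_i^{m_i}$ is a bijection of $D$ onto $Y$. Put $$\Pi(t,x)=\widetilde A^{-1}(Q_1+Q_{2\Sigma})[f(t,x)-Bx],\quad F_{2*}(t,x_1,x_{2\Sigma},x_{20})=Q_{2*}f(t,x_1+x_{2\Sigma}+x_{20})-Q_{2*}B(x_{20}+x_{2\Sigma}),$$ $$L_0=\{(t,x)\in\mathbb R_+\times D:\ Q_{2*}[f(t,x)-Bx]=0\}.$$ **Theorem (global solvability, Lipschitz variant).** Assume that: 1. For all $t\in\mathbb R_+$, $x_1\in D_1$, $x_{2\Sigma}\in D_{2\Sigma}$ there is a unique $x_{20}\in D_{20}$ with $(t,x_1+x_{2\Sigma}+x_{20})\in L_0$. 2. There are operators $W_{t,x}\in\mathcal L(D_{20},Y_{2*})$ with inverses $W_{t,x}^{-1}\in\mathcal L(Y_{2*},D_{20})$, $(t,x)\in L_0$, such that one of the following holds. (a)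 $f(t,x)$ is locally Lipschitz with respect to $x$ on $\mathbb R_+\times D$, and for each $(t',x')\in L_0$ and all sufficiently small $\delta,\varepsilon>0$, $$\|F_{2*}(t,x_1,x_{2\Sigma},u)-F_{2*}(t,x_1,x_{2\Sigma},v)-W_{t',x'}[u-v]\|\le q(\delta,\varepsilon)\|u-v\|$$ whenever $t\in\mathbb R_+$, $x_1\in D_1$, $x_{2\Sigma}\in D_{2\Sigma}$ satisfy $|t-t'|<\delta$, $\|x_1-x_1'\|<\delta$, $\|x_{2\Sigma}-x_{2\Sigma}'\|<\delta$, and $u,v\in D_{20}$ satisfy $\|u-x_{20}'\|<\varepsilon$, $\|v-x_{20}'\|<\varepsilon$; here $q$ may depend on $(t',x')$ and $\lim_{\delta,\varepsilon\to0}q(\delta,\varepsilon)<\|W_{t',x'}^{-1}\|^{-1}$ (no restriction on the limit if $D_{20}=\{0\}$). (b) $f$ has a continuous partial Fréchet derivative with respect to $x$ on $\mathbb R_+\times D$, and $W_{t,x}=[\partial_x(Q_{2*}f)(t,x)-Q_{2*}B]\big|_{D_{20}}$ for $(t,x)\in L_0$. 3. For all $a_1,a_2>0$ there is $K=K(a_1,a_2)>0$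 such that $\|x_{20}-W_{t,x}^{-1}F_{2*}(t,x_1,x_{2\Sigma},x_{20})\|\le K$ for all $(t,x)\in L_0$ with $t\le a_1$, $\|x_1+x_{2\Sigma}\|\le a_2$, and $\|(Q_1+Q_{2\Sigma})f(t,x)\|$ is bounded on the set of those $(t,x)\in L_0$ for which $t\le a_1$, $\|x_1+x_{2\Sigma}\|\le a_2$, $\|x_{20}\|\le K$. 4. There are $R>0$, a functional $V\in C(W,\mathbb R_+)$ that satisfies a Lipschitz condition on $\{w\in W:\|w\|\ge R\}$, a function $U\in C(\mathbb R_+,\mathbb R_+)$ and a function $\psi:\mathbb R_+\to\mathbb R_+$ integrable on each finite interval, such that $$\int_{u_0}^\infty\frac{du}{U(u)}=\infty\ \text{ for every }u_0>0,\qquad \lim_{\|w\|\to\infty}V(w)=\infty$$ (with $1/U(u)=\infty$ where $U(u)=0$), and for all $t\in\mathbb R_+$, $w\in W$, $x_{20}\in D_{20}$ with $\|w\|\ge R$ and $(t,\widetilde A^{-1}w+x_{20})\in L_0$, $$\big\|\widetilde A\,\Pi(t,\widetilde A^{-1}w+x_{20})\big\|\le U(V(w))\,\psi(t).$$ Then for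 each initial point $(t_0,x_0)\in L_0$ the initial value problem (1) has a unique global solution: there is a solution $x$ on $[t_0,\infty)$ with $x(t_0)=x_0$, and every solution $y$ with $y(t_0)=x_0$ on an interval $J$ whose least element is $t_0$ coincides with $x$ on $J$. -/

import Mathlib

open Set Filter Topology MeasureTheory

noncomputable section

namespace ADAE

/-! Notation: `X`, `Y` are Banach spaces over `𝕜 = ℝ` or `ℂ`, `D` is a linear manifold in `X` with the
norm of `X`, and `a b : D → Y` are the restrictions to `D` of the operators `A`, `B`. -/

section Pencil

variable {𝕜 X Y : Type*} [RCLike 𝕜] [NormedAddCommGroup X] [NormedSpace 𝕜 X]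
  [NormedAddCommGroup Y] [NormedSpace 𝕜 Y] {D : Submodule 𝕜 X}

/-- The complexification of `A + μ B`, `μ ∈ ℂ`, written on pairs `(x, y) = x + i y`. -/
def complexPencil (a b : D →ₗ[𝕜] Y) (μ : ℂ) (d : D × D) : Y × Y :=
  (a d.1 + ((μ.re : ℝ) : 𝕜) • b d.1 - ((μ.im : ℝ) : 𝕜) • b d.2,
   a d.2 + ((μ.im : ℝ) : 𝕜) • b d.1 + ((μ.re : ℝ) : 𝕜) • b d.2)

/-- For all complex `μ ≠ 0` near `0` the (complexified) pencil `A + μ B` has a bounded inverse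
defined on the whole space, and the norm of the inverse is at most `C / |μ| ^ k`.
For `𝕜 = ℂ` this is the same as the direct condition on `A + μ B : D → Y`,
see `resolventBound_iff` below. -/
def ResolventBound (a b : D →ₗ[𝕜] Y) (k : ℕ) : Prop :=
  ∃ C ρ : ℝ, 0 < ρ ∧ ∀ μ : ℂ, μ ≠ 0 → ‖μ‖ ≤ ρ → ∃ S : (Y × Y) →L[𝕜] (X × X),
    (∀ z, ∃ d : D × D, ((d.1 : X), (d.2 : X)) = S z ∧ complexPencil a b μ d = z) ∧
    (∀ d : D × D, S (complexPencil a b μ d) = ((d.1 : X), (d.2 : X))) ∧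
    ‖S‖ ≤ C / ‖μ‖ ^ k

/-- `λ A + B` is a regular pencil of index `ν`: the point `μ = 0` is a pole of order `ν` of
`(A + μ B)⁻¹` (`ν = 0`: removable singularity, that is, `A` has a bounded inverse on `Y`). -/
def HasPencilIndex (a b : D →ₗ[𝕜] Y) (ν : ℕ) : Prop :=
  IsLeast {k | ResolventBound a b k} ν

end Pencil

section PencilComplex

variable {X Y : Type*} [NormedAddCommGroup X] [NormedSpace ℂ X]
  [NormedAddCommGroup Y] [NormedSpace ℂ Y] {D : Submodule ℂ X}

theorem complexPencil_add (a b : D →ₗ[ℂ] Y) (μ : ℂ) (d : D × D) :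
    (complexPencil a b μ d).1 + Complex.I • (complexPencil a b μ d).2 =
      a (d.1 + Complex.I • d.2) + μ • b (d.1 + Complex.I • d.2) := by
  obtain ⟨r, s, rfl⟩ : ∃ r s : ℝ, μ = r + s * Complex.I := ⟨μ.re, μ.im, (Complex.re_add_im μ).symm⟩
  simp only [complexPencil, map_add, map_smul]
  simp
  match_scalars <;> ring_nf <;> simp <;> ring

theorem complexPencil_sub (a b : D →ₗ[ℂ] Y) (μ : ℂ) (d : D × D) :
    (complexPencil a b μ d).1 - Complex.I • (complexPencil a b μ d).2 =
      a (d.1 - Complex.I • d.2) +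
        (starRingEnd ℂ μ) • b (d.1 - Complex.I • d.2) := by
  obtain ⟨r, s, rfl⟩ : ∃ r s : ℝ, μ = r + s * Complex.I := ⟨μ.re, μ.im, (Complex.re_add_im μ).symm⟩
  simp only [complexPencil, map_sub, map_smul]
  simp
  match_scalars <;> ring_nf <;> simp <;> ring

theorem pair_ext {Z : Type*} [AddCommGroup Z] [Module ℂ Z] {p q : Z × Z}
    (h1 : p.1 + Complex.I • p.2 = q.1 + Complex.I • q.2)
    (h2 : p.1 - Complex.I • p.2 = q.1 - Complex.I • q.2) : p = q := by
  have e1 : ∀ r : Z × Z, r.1 = (1 / 2 : ℂ) • ((r.1 + Complex.I • r.2) + (r.1 - Complex.I • r.2)) := by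
    intro r
    match_scalars <;> ring_nf
  have e2 : ∀ r : Z × Z,
      r.2 = (-Complex.I / 2 : ℂ) • ((r.1 + Complex.I • r.2) - (r.1 - Complex.I • r.2)) := by
    intro r
    match_scalars <;> ring_nf
    simp [Complex.I_sq]
  ext
  · rw [e1 p, e1 q, h1, h2]
  · rw [e2 p, e2 q, h1, h2]

/-- Over `ℂ`, the bound may be read off from `A + μ B` itself, without complexification. -/
theorem resolventBound_iff (a b : D →ₗ[ℂ] Y) (k : ℕ) :
    ResolventBound a b k ↔ ∃ C ρ : ℝ, 0 < ρ ∧ ∀ μ : ℂ, μ ≠ 0 → ‖μ‖ ≤ ρ → ∃ S : Y →L[ℂ] X,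
      (∀ y, ∃ d : D, (d : X) = S y ∧ a d + μ • b d = y) ∧
      (∀ d : D, S (a d + μ • b d) = d) ∧ ‖S‖ ≤ C / ‖μ‖ ^ k := by
  constructor
  · rintro ⟨C, ρ, hρ, h⟩
    refine ⟨C, ρ, hρ, fun μ h0 h1 => ?_⟩
    obtain ⟨S, hS1, hS2, hS3⟩ := h μ h0 h1
    have key : ∀ d : D, complexPencil a b μ (d, -(Complex.I • d)) =
        (a d + μ • b d, -(Complex.I • (a d + μ • b d))) := by
      intro d
      have hI : d + Complex.I • -(Complex.I • d) = d + d := by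
        match_scalars; ring_nf; simp [Complex.I_sq]; norm_num
      have hI' : d - Complex.I • -(Complex.I • d) = 0 := by
        match_scalars; ring_nf; simp [Complex.I_sq]
      apply pair_ext
      · rw [complexPencil_add]
        simp only [hI, map_add]
        match_scalars <;> ring_nf <;> simp [Complex.I_sq] <;> ring_nf
      · rw [complexPencil_sub]
        simp only [hI', map_zero]
        match_scalars <;> ring_nf <;> simp [Complex.I_sq]
    let J : Y →L[ℂ] Y × Y :=
      (ContinuousLinearMap.id ℂ Y).prod (-(Complex.I • ContinuousLinearMap.id ℂ Y))
    have hJ : ∀ y, J y = (y, -(Complex.I • y)) := fun y => rfl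
    let T : Y →L[ℂ] X := (ContinuousLinearMap.fst ℂ X X).comp (S.comp J)
    have hT : ∀ y, T y = (S (y, -(Complex.I • y))).1 := fun y => rfl
    have hTd : ∀ d : D, T (a d + μ • b d) = d := by
      intro d
      rw [hT, ← key, hS2]
    refine ⟨T, fun y => ?_, hTd, ?_⟩
    · obtain ⟨d, -, hd⟩ := hS1 (y, -(Complex.I • y))
      have h3 := complexPencil_add a b μ d
      rw [hd] at h3
      let e : D := (1 / 2 : ℂ) • (d.1 + Complex.I • d.2)
      have he : a e + μ • b e = y := by
        have : a e + μ • b e = (1 / 2 : ℂ) • (a (d.1 + Complex.I • d.2) +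
            μ • b (d.1 + Complex.I • d.2)) := by
          simp only [e, map_smul]; module
        rw [this, ← h3]
        match_scalars
        ring_nf; simp [Complex.I_sq]; norm_num
      refine ⟨e, ?_, he⟩
      conv_rhs => rw [← he]
      exact (hTd e).symm
    · refine le_trans ?_ hS3
      refine ContinuousLinearMap.opNorm_le_bound _ (norm_nonneg _) fun y => ?_
      rw [hT]
      refine (norm_fst_le _).trans ((S.le_opNorm _).trans ?_)
      simp [Prod.norm_def, norm_smul]
  · rintro ⟨C, ρ, hρ, h⟩
    refine ⟨2 * C, ρ, hρ, fun μ h0 h1 => ?_⟩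
    obtain ⟨T, hT1, hT2, hT3⟩ := h μ h0 h1
    obtain ⟨T', hT1', hT2', hT3'⟩ := h (starRingEnd ℂ μ) (by simpa using h0) (by simpa using h1)
    rw [RCLike.norm_conj] at hT3'
    let U : Y × Y →L[ℂ] X := T.comp
      (ContinuousLinearMap.fst ℂ Y Y + Complex.I • ContinuousLinearMap.snd ℂ Y Y)
    let V : Y × Y →L[ℂ] X := T'.comp
      (ContinuousLinearMap.fst ℂ Y Y - Complex.I • ContinuousLinearMap.snd ℂ Y Y)
    have hU : ∀ z, U z = T (z.1 + Complex.I • z.2) := fun z => rfl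
    have hV : ∀ z, V z = T' (z.1 - Complex.I • z.2) := fun z => rfl
    let S : Y × Y →L[ℂ] X × X :=
      ((1 / 2 : ℂ) • (U + V)).prod ((-Complex.I / 2 : ℂ) • (U - V))
    have hS : ∀ z, S z = ((1 / 2 : ℂ) • (U z + V z), (-Complex.I / 2 : ℂ) • (U z - V z)) :=
      fun z => rfl
    have hSd : ∀ d : D × D, S (complexPencil a b μ d) = ((d.1 : X), (d.2 : X)) := by
      intro d
      rw [hS, hU, hV, complexPencil_add, complexPencil_sub, hT2, hT2']
      ext
      · simp only [Submodule.coe_add, Submodule.coe_sub, Submodule.coe_smul]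
        match_scalars <;> ring_nf
      · simp only [Submodule.coe_add, Submodule.coe_sub, Submodule.coe_smul]
        match_scalars <;> ring_nf
        simp [Complex.I_sq]
    refine ⟨S, fun z => ?_, hSd, ?_⟩
    · obtain ⟨u, -, hu⟩ := hT1 (z.1 + Complex.I • z.2)
      obtain ⟨v, -, hv⟩ := hT1' (z.1 - Complex.I • z.2)
      let d : D × D := ((1 / 2 : ℂ) • (u + v), (-Complex.I / 2 : ℂ) • (u - v))
      have hd1 : d.1 + Complex.I • d.2 = u := by
        simp only [d]
        match_scalars <;> ring_nf <;> simp [Complex.I_sq]; norm_num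
      have hd2 : d.1 - Complex.I • d.2 = v := by
        simp only [d]
        match_scalars <;> ring_nf <;> simp [Complex.I_sq]; norm_num
      have he : complexPencil a b μ d = z := by
        apply pair_ext
        · rw [complexPencil_add, hd1, hu]
        · rw [complexPencil_sub, hd2, hv]
      refine ⟨d, ?_, he⟩
      conv_rhs => rw [← he]
      exact (hSd d).symm
    · have hC : 0 ≤ C / ‖μ‖ ^ k := (norm_nonneg _).trans hT3
      have b1 : ∀ z, ‖U z‖ ≤ C / ‖μ‖ ^ k * (2 * ‖z‖) := by
        intro z
        rw [hU]
        refine (T.le_opNorm _).trans (mul_le_mul hT3 ?_ (norm_nonneg _) hC)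
        refine (norm_add_le _ _).trans ?_
        rw [norm_smul, Complex.norm_I, one_mul, two_mul]
        exact add_le_add (norm_fst_le z) (norm_snd_le z)
      have b2 : ∀ z, ‖V z‖ ≤ C / ‖μ‖ ^ k * (2 * ‖z‖) := by
        intro z
        rw [hV]
        refine (T'.le_opNorm _).trans (mul_le_mul hT3' ?_ (norm_nonneg _) hC)
        refine (norm_sub_le _ _).trans ?_
        rw [norm_smul, Complex.norm_I, one_mul, two_mul]
        exact add_le_add (norm_fst_le z) (norm_snd_le z)
      have hC2 : 2 * C / ‖μ‖ ^ k = 2 * (C / ‖μ‖ ^ k) := by ring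
      rw [hC2]
      refine ContinuousLinearMap.opNorm_le_bound _ (by positivity) fun z => ?_
      rw [hS, Prod.norm_def, norm_smul, norm_smul]
      have n1 := norm_add_le (U z) (V z)
      have n2 := norm_sub_le (U z) (V z)
      have n3 := b1 z
      have n4 := b2 z
      simp only [norm_neg, norm_div, Complex.norm_I, norm_one, Complex.norm_ofNat]
      refine max_le ?_ ?_ <;> linarith

end PencilComplex

section Decomposition

variable {𝕜 X Y : Type*} [RCLike 𝕜] [NormedAddCommGroup X] [NormedSpace 𝕜 X]
  [NormedAddCommGroup Y] [NormedSpace 𝕜 Y] {D : Submodule 𝕜 X}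

/-- A canonical system `φ i j` (`1 ≤ j ≤ m i`) of eigenvectors and adjoined vectors of `A + μ B` for
the eigenvalue `μ = 0`, together with the functionals `q i j ∈ Y*` biorthogonal to `B (φ i j)`.
The second index starts at `1`; the values of `φ`, `q` outside `1 ≤ j ≤ m i` are never used.
The relations `A* q i (m i) = 0` and `A* q i j = - B* q i (j + 1)` are expressed on `D`. -/
structure CanonicalSystem (a b : D →ₗ[𝕜] Y) (n ν : ℕ) where
  m : Fin n → ℕ
  φ : Fin n → ℕ → D
  q : Fin n → ℕ → Y →L[𝕜] 𝕜
  one_le_m : ∀ i, 1 ≤ m i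
  sup_m : Finset.univ.sup m = ν
  linearIndependent : LinearIndependent 𝕜 fun i => φ i 1
  span_eq_ker : Submodule.span 𝕜 (Set.range fun i => φ i 1) = LinearMap.ker a
  chain : ∀ i, ∀ j ∈ Finset.Icc 2 (m i), a (φ i j) = -b (φ i (j - 1))
  dual_last : ∀ i, ∀ x : D, q i (m i) (a x) = 0
  dual_chain : ∀ i, ∀ j ∈ Finset.Ico 1 (m i), ∀ x : D, q i j (a x) = -q i (j + 1) (b x)
  biorthogonal : ∀ i k, ∀ j ∈ Finset.Icc 1 (m i), ∀ l ∈ Finset.Icc 1 (m k),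
    q k l (b (φ i j)) = if i = k ∧ j = l then 1 else 0

namespace CanonicalSystem

variable {a b : D →ₗ[𝕜] Y} {n ν : ℕ} (S : CanonicalSystem a b n ν)

/-- `x ↦ ⟨x, B* q i j⟩ φ i j` on `D`. -/
def projTerm (i : Fin n) (j : ℕ) : D →ₗ[𝕜] D :=
  ((S.q i j : Y →ₗ[𝕜] 𝕜).comp b).smulRight (S.φ i j)

/-- `y ↦ ⟨y, q i j⟩ B (φ i j)` on `Y`. -/
def projTermY (i : Fin n) (j : ℕ) : Y →L[𝕜] Y :=
  (S.q i j).smulRight (b (S.φ i j))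

def P20 : D →ₗ[𝕜] D := ∑ i, S.projTerm i 1

def P2Sigma : D →ₗ[𝕜] D := ∑ i, ∑ j ∈ Finset.Icc 2 (S.m i), S.projTerm i j

def P2 : D →ₗ[𝕜] D := ∑ i, ∑ j ∈ Finset.Icc 1 (S.m i), S.projTerm i j

def P1 : D →ₗ[𝕜] D := LinearMap.id - S.P2

def Q2Star : Y →L[𝕜] Y := ∑ i, S.projTermY i (S.m i)

def Q2Sigma : Y →L[𝕜] Y := ∑ i, ∑ j ∈ Finset.Ico 1 (S.m i), S.projTermY i j

def Q2 : Y →L[𝕜] Y := ∑ i, ∑ j ∈ Finset.Icc 1 (S.m i), S.projTermY i j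

def Q1 : Y →L[𝕜] Y := ContinuousLinearMap.id 𝕜 Y - S.Q2

def D1 : Submodule 𝕜 D := LinearMap.range S.P1

def D2Sigma : Submodule 𝕜 D :=
  Submodule.span 𝕜 {x | ∃ i, ∃ j ∈ Finset.Icc 2 (S.m i), x = S.φ i j}

/-- `D₂₀ = ker A`. -/
def D20 (_S : CanonicalSystem a b n ν) : Submodule 𝕜 D := LinearMap.ker a

def Y1 : Submodule 𝕜 Y := LinearMap.range (S.Q1 : Y →ₗ[𝕜] Y)

def Y2Sigma : Submodule 𝕜 Y :=
  Submodule.span 𝕜 {y | ∃ i, ∃ j ∈ Finset.Ico 1 (S.m i), y = b (S.φ i j)}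

def Y2Star : Submodule 𝕜 Y := Submodule.span 𝕜 (Set.range fun i => b (S.φ i (S.m i)))

/-- `W = Y₁ ∔ Y_{2Σ}`. -/
def W : Submodule 𝕜 Y := S.Y1 ⊔ S.Y2Sigma

theorem Q2Star_mem (y : Y) : S.Q2Star y ∈ S.Y2Star := by
  simp only [Q2Star, projTermY, _root_.sum_apply,
    ContinuousLinearMap.smulRight_apply]
  exact Submodule.sum_mem _ fun i _ =>
    Submodule.smul_mem _ _ (Submodule.subset_span (Set.mem_range_self i))

/-- `Ã = A + ∑ i, ⟨·, B* q i 1⟩ B (φ i (m i))` on `D`. -/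
def Atilde : D →ₗ[𝕜] Y :=
  a + ∑ i, ((S.q i 1 : Y →ₗ[𝕜] 𝕜).comp b).smulRight (b (S.φ i (S.m i)))

/-- `Ã⁻¹ : Y → D` (`Ã` is bijective for a regular pencil of index `ν` with closed `A`, `B`). -/
def AtildeInv : Y → D := Function.invFun S.Atilde

/-- `Π(t, x) = Ã⁻¹ (Q₁ + Q_{2Σ}) [f(t, x) - B x]`. -/
def Pi (f : ℝ → D → Y) (t : ℝ) (x : D) : D :=
  S.AtildeInv ((S.Q1 + S.Q2Sigma) (f t x - b x))

/-- `F_{2*}(t, x₁, x_{2Σ}, x₂₀) = Q_{2*} f(t, x₁ + x_{2Σ} + x₂₀) - Q_{2*} B (x₂₀ + x_{2Σ})`. -/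
def F2Star (f : ℝ → D → Y) (t : ℝ) (x1 x2 x20 : D) : S.Y2Star :=
  ⟨S.Q2Star (f t (x1 + x2 + x20)) - S.Q2Star (b (x20 + x2)),
    sub_mem (S.Q2Star_mem _) (S.Q2Star_mem _)⟩

/-- The consistency manifold `L₀`. -/
def L0 (f : ℝ → D → Y) : Set (ℝ × D) :=
  {p | 0 ≤ p.1 ∧ S.Q2Star (f p.1 p.2 - b p.2) = 0}

/-- For all `t ≥ 0`, `x₁ ∈ D₁`, `x_{2Σ} ∈ D_{2Σ}` there is a unique `x₂₀ ∈ D₂₀` such that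
`(t, x₁ + x_{2Σ} + x₂₀) ∈ L₀`. -/
def UniqueConsistency (f : ℝ → D → Y) : Prop :=
  ∀ t : ℝ, 0 ≤ t → ∀ x1 ∈ S.D1, ∀ x2 ∈ S.D2Sigma,
    ∃! x20 : D, x20 ∈ S.D20 ∧ (t, x1 + x2 + x20) ∈ S.L0 f

/-- `f(t, x)` satisfies locally a Lipschitz condition with respect to `x` on `ℝ₊ × D`. -/
def _root_.ADAE.LocallyLipschitzInX (f : ℝ → D → Y) : Prop :=
  ∀ t' : ℝ, 0 ≤ t' → ∀ x' : D, ∃ δ > 0, ∃ L : ℝ, 0 ≤ L ∧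
    ∀ t : ℝ, 0 ≤ t → |t - t'| < δ → ∀ x ∈ Metric.ball x' δ, ∀ y ∈ Metric.ball x' δ,
      ‖f t x - f t y‖ ≤ L * ‖x - y‖

/-- The Lipschitz variant of the condition on `f` and on the family of invertible operators
`W_{t,x} : D₂₀ → Y_{2*}`, `(t, x) ∈ L₀`. The inequality `lim q < ‖W⁻¹‖⁻¹` is written as
`(lim q) ‖W⁻¹‖ < 1`, which also makes sense when `D₂₀ = {0}`. -/
def LipschitzCondition (f : ℝ → D → Y) (W : ℝ → D → (S.D20 ≃L[𝕜] S.Y2Star)) : Prop :=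
  LocallyLipschitzInX f ∧
  ∀ t' : ℝ, ∀ x' : D, (t', x') ∈ S.L0 f →
    ∃ δ₀ > 0, ∃ ε₀ > 0, ∃ (q : ℝ × ℝ → ℝ) (l : ℝ),
      Tendsto q (𝓝[>] 0 ×ˢ 𝓝[>] 0) (𝓝 l) ∧
      l * ‖((W t' x').symm : S.Y2Star →L[𝕜] S.D20)‖ < 1 ∧
      ∀ δ ∈ Set.Ioc 0 δ₀, ∀ ε ∈ Set.Ioc 0 ε₀,
        ∀ t : ℝ, 0 ≤ t → |t - t'| < δ →
        ∀ x1 ∈ S.D1, ‖x1 - S.P1 x'‖ < δ →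
        ∀ x2 ∈ S.D2Sigma, ‖x2 - S.P2Sigma x'‖ < δ →
        ∀ u v : S.D20, ‖(u : D) - S.P20 x'‖ < ε → ‖(v : D) - S.P20 x'‖ < ε →
          ‖S.F2Star f t x1 x2 u - S.F2Star f t x1 x2 v - W t' x' (u - v)‖ ≤ q (δ, ε) * ‖u - v‖

/-- The smooth variant: `f` has a continuous partial (Fréchet) derivative with respect to `x` on
`ℝ₊ × D` and `W_{t,x} = [∂ₓ(Q_{2*} f)(t, x) - Q_{2*} B]` on `D₂₀`, `(t, x) ∈ L₀`, is invertible. -/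
def SmoothCondition (f : ℝ → D → Y) (W : ℝ → D → (S.D20 ≃L[𝕜] S.Y2Star)) : Prop :=
  ∃ f' : ℝ → D → (D →L[𝕜] Y),
    (∀ t : ℝ, 0 ≤ t → ∀ x : D, HasFDerivAt (𝕜 := 𝕜) (f t) (f' t x) x) ∧
    ContinuousOn (fun p : ℝ × D => f' p.1 p.2) (Set.Ici 0 ×ˢ Set.univ) ∧
    ∀ t : ℝ, ∀ x : D, (t, x) ∈ S.L0 f →
      ∀ v : S.D20, (W t x v : Y) = S.Q2Star (f' t x v) - S.Q2Star (b v)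

/-- For all `a₁, a₂ > 0` there is a bound `K > 0` for `‖x₂₀ - W_{t,x}⁻¹ F_{2*}‖`, and
`(Q₁ + Q_{2Σ}) f` is bounded, on the corresponding parts of `L₀`. -/
def BoundednessCondition (f : ℝ → D → Y) (W : ℝ → D → (S.D20 ≃L[𝕜] S.Y2Star)) : Prop :=
  ∀ a₁ > (0 : ℝ), ∀ a₂ > (0 : ℝ), ∃ K > (0 : ℝ),
    (∀ t : ℝ, ∀ x : D, (t, x) ∈ S.L0 f → t ≤ a₁ → ‖S.P1 x + S.P2Sigma x‖ ≤ a₂ →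
      ‖S.P20 x - (W t x).symm (S.F2Star f t (S.P1 x) (S.P2Sigma x) (S.P20 x))‖ ≤ K) ∧
    ∃ C : ℝ, ∀ t : ℝ, ∀ x : D, (t, x) ∈ S.L0 f → t ≤ a₁ → ‖S.P1 x + S.P2Sigma x‖ ≤ a₂ →
      ‖S.P20 x‖ ≤ K → ‖(S.Q1 + S.Q2Sigma) (f t x)‖ ≤ C

/-- The growth condition with a functional `V` that is Lipschitz on `{w ∈ W : ‖w‖ ≥ R}`.
In the integral, `1 / U(u) = ∞` where `U(u) = 0`. -/
def GrowthCondition (f : ℝ → D → Y) : Prop :=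
  ∃ R > (0 : ℝ), ∃ (V : S.W → ℝ) (U ψ : ℝ → ℝ),
    Continuous V ∧ (∀ w, 0 ≤ V w) ∧
    ContinuousOn U (Set.Ici 0) ∧ (∀ u, 0 ≤ u → 0 ≤ U u) ∧
    (∀ t, 0 ≤ t → 0 ≤ ψ t) ∧ (∀ T, 0 ≤ T → IntegrableOn ψ (Set.Icc 0 T)) ∧
    (∀ u₀ > (0 : ℝ), ∫⁻ u in Set.Ioi u₀, (ENNReal.ofReal (U u))⁻¹ = ⊤) ∧
    Tendsto V (comap norm atTop) atTop ∧
    (∃ l : ℝ, 0 ≤ l ∧ ∀ w₁ w₂ : S.W, R ≤ ‖w₁‖ → R ≤ ‖w₂‖ → |V w₁ - V w₂| ≤ l * ‖w₁ - w₂‖) ∧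
    ∀ t : ℝ, ∀ w : S.W, ∀ x20 ∈ S.D20, R ≤ ‖w‖ → (t, S.AtildeInv w + x20) ∈ S.L0 f →
      ‖S.Atilde (S.Pi f t (S.AtildeInv w + x20))‖ ≤ U (V w) * ψ t

end CanonicalSystem

end Decomposition

section Solution

variable {𝕜 X Y : Type*} [RCLike 𝕜] [NormedAddCommGroup X] [NormedSpace 𝕜 X]
  [NormedAddCommGroup Y] [NormedSpace 𝕜 Y] [NormedSpace ℝ Y] {D : Submodule 𝕜 X}

open Classical in
/-- `x` is a solution of `d/dt [A x] + B x = f(t, x)` on the interval `J ⊆ ℝ₊`: `x ∈ C(J, X)`,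
`x(t) ∈ D`, `A x ∈ C¹(J, Y)` and the equation holds on `J`; if `J = ℝ₊`, the last two requirements
concern `(0, ∞)`. Derivatives at an endpoint that belongs to `J` are one-sided. -/
def IsSolutionOn (a b : D →ₗ[𝕜] Y) (f : ℝ → D → Y) (J : Set ℝ) (x : ℝ → D) : Prop :=
  let J' : Set ℝ := if J = Set.Ici 0 then Set.Ioi 0 else J
  ContinuousOn x J ∧ ContDiffOn ℝ 1 (fun t => a (x t)) J' ∧
    ∀ t ∈ J', derivWithin (fun s => a (x s)) J' t + b (x t) = f t (x t)

/-- The initial value problem `x(t₀) = x₀` has a unique global solution: there is a solution `x` on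
`[t₀, ∞)`, and every solution with this initial value, on any interval that starts at `t₀`,
coincides with `x` on that interval. -/
def HasUniqueGlobalSolution (a b : D →ₗ[𝕜] Y) (f : ℝ → D → Y) (t₀ : ℝ) (x₀ : D) : Prop :=
  ∃ x : ℝ → D, IsSolutionOn a b f (Set.Ici t₀) x ∧ x t₀ = x₀ ∧
    ∀ J : Set ℝ, J.OrdConnected → IsLeast J t₀ → ∀ y : ℝ → D,
      IsSolutionOn a b f J y → y t₀ = x₀ → Set.EqOn y x J

end Solution

end ADAE

end

/-!
The equation is reduced to an ordinary differential equation for `w = A x`, which takes its values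
in the closed subspace `W = ker Q_{2*}` of `Y`. On `D₁ ∔ D_{2Σ} = ker P₂₀` the operators `A` and `Ã`
coincide, and `Ã` maps this space onto `W`, so `x = Ã⁻¹ w + x₂₀` with `x₂₀ ∈ ker A`. A solution stays
in `L₀`, and there the unique solvability of the algebraic part makes `x₂₀ = η(t, w)` a function of
`(t, w)`. Thus `x` solves the original problem exactly when `w` solves
`w' = G(t, w) = (Q₁ + Q_{2Σ}) [f(t, x) - B x]` with `x = Ã⁻¹ w + η(t, w)` (`Reduction`).

The operators `Ã⁻¹` and `B Ã⁻¹` are bounded although `B` need not be (`exists_inverse_Atilde`). In the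
graph norm of `A` the domain `D` is a Banach space on which `A` and `B` are bounded; there `Ã` is
injective with closed range, hence bounded below. For small `r > 0` the operator `Ã + r B` is an
injective finite-rank perturbation of the bijection `A + r B`, hence onto, and letting `r → 0` gives
surjectivity of `Ã`.

Under either variant of the condition on the operators `W_{t,x}`, the map `u ↦ u - W⁻¹ F_{2*}` is a
contraction near each point of `L₀` (`LipschitzCondition.contraction`,
`SmoothCondition.contraction`). As `η(t, w)` is the only zero of `F_{2*}`, it is continuous and
locally Lipschitz in `w`, and so is `G`.

Solutions of the reduced equation exist locally and are unique. They are continued by an a priori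
bound (`exists_norm_le_of_growth`): where `‖w‖ ≥ R`, the function `v(t) = V(w(t))` grows no faster
than solutions of `v' = l U(v) ψ(t)`, which cannot blow up because `∫ du / U(u)` diverges. Since `V`
is only Lipschitz, this is shown on short time intervals for `Φ(v)` with `Φ' = 1 / (U + ε)`. The
boundedness condition bounds `G` on bounded sets, so bounded solutions can be continued
(`exists_rightSol_of_bounded`).

For uniqueness on `[0, ∞)` the equation is given on `(0, ∞)` only, and it has to be shown that `A x`
is continuous at `0` (`tendsto_a_initial`). The part `Q₁ A x` solves a linear equation with bounded
coefficients and hence converges. The remaining part of `x` lies in the finite-dimensional span of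
the root vectors, where `A` is bounded; the limit is `A x(0)` because `A` is closed.
-/

noncomputable section

namespace ADAE

/-! ### Ordinary differential equations with a locally Lipschitz right-hand side -/

section ODE

variable {E : Type*} [NormedAddCommGroup E] [NormedSpace ℝ E]

/-- `G t` is Lipschitz near every point, with a constant that is uniform for nearby `t`. -/
def LocLipschitz (G : ℝ → E → E) : Prop :=
  ∀ t' : ℝ, ∀ w' : E, ∃ δ > 0, ∃ K : NNReal, ∀ t : ℝ, |t - t'| < δ →
    LipschitzOnWith K (G t) (Metric.ball w' δ)

/-- `α` solves `w' = G(t, w)` on `[a, b]`. Only right derivatives, on `[a, b)`, are required; for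
continuous `G` this is equivalent to the usual notion, and it makes gluing solutions painless. -/
structure RightSol (G : ℝ → E → E) (a b : ℝ) (α : ℝ → E) : Prop where
  cont : ContinuousOn α (Icc a b)
  deriv : ∀ t ∈ Ico a b, HasDerivWithinAt α (G t (α t)) (Ici t) t

theorem RightSol.mono {G : ℝ → E → E} {a b a' b' : ℝ} {α : ℝ → E} (h : RightSol G a b α)
    (ha : a ≤ a') (hb : b' ≤ b) : RightSol G a' b' α :=
  ⟨h.cont.mono (Icc_subset_Icc ha hb), fun t ht => h.deriv t ⟨ha.trans ht.1, ht.2.trans_le hb⟩⟩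

/-- Projecting the time to `[a, b]` extends the right-hand side along a solution continuously. -/
theorem continuous_comp_projIcc {E : Type*} [TopologicalSpace E] {G : ℝ → E → E}
    (hG : Continuous fun p : ℝ × E => G p.1 p.2) {a b : ℝ} (hab : a ≤ b) {α : ℝ → E} (hα : ContinuousOn α (Icc a b)) :
    Continuous fun t => G t (α (projIcc a b hab t)) := by
  have : Continuous fun t => α (projIcc a b hab t) := by
    have := hα.domRestrict.comp (continuous_projIcc (h := hab))
    exact this
  exact hG.comp (continuous_id.prodMk this)

/-- A function that is continuous on `[a, b]` and solves the equation in the interior satisfies the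
integral equation; the integrand is made continuous on `ℝ` by the projection to `[a, b]`. -/
theorem eq_add_integral_of_hasDerivWithinAt [CompleteSpace E] {G : ℝ → E → E}
    (hG : Continuous fun p : ℝ × E => G p.1 p.2) {a b : ℝ} (hab : a ≤ b) {α : ℝ → E}
    (hα : ContinuousOn α (Icc a b))
    (hd : ∀ t ∈ Ioo a b, HasDerivWithinAt α (G t (α t)) (Ioi t) t) :
    ∀ t ∈ Icc a b, α t = α a + ∫ s in a..t, G s (α (projIcc a b hab s)) := by
  intro t ht
  have hc := continuous_comp_projIcc hG hab hα
  rw [intervalIntegral.integral_eq_sub_of_hasDeriv_right_of_le ht.1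
    (hα.mono (Icc_subset_Icc_right ht.2)) (f' := fun s => G s (α (projIcc a b hab s)))
    ?_ (hc.intervalIntegrable _ _)]
  · abel
  · intro s hs
    have hs' : s ∈ Ioo a b := ⟨hs.1, hs.2.trans_le ht.2⟩
    have := hd s hs'
    rwa [projIcc_of_mem hab ⟨hs'.1.le, hs'.2.le⟩]

/-- Solvability in the open interval and continuity up to the boundary suffice: the right derivative
at `a` comes from the integral equation. -/
theorem RightSol.of_Ioo [CompleteSpace E] {G : ℝ → E → E}
    (hG : Continuous fun p : ℝ × E => G p.1 p.2) {a b : ℝ} {α : ℝ → E}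
    (hα : ContinuousOn α (Icc a b))
    (hd : ∀ t ∈ Ioo a b, HasDerivWithinAt α (G t (α t)) (Ioi t) t) : RightSol G a b α := by
  refine ⟨hα, fun t ht => ?_⟩
  have hab : a ≤ b := (ht.1.trans_lt ht.2).le
  have hint := eq_add_integral_of_hasDerivWithinAt hG hab hα hd
  have hc := continuous_comp_projIcc hG hab hα
  have h1 : HasDerivAt (fun t => α a + ∫ s in a..t, G s (α (projIcc a b hab s)))
      (G t (α (projIcc a b hab t))) t :=
    (intervalIntegral.integral_hasDerivAt_right (hc.intervalIntegrable _ _)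
      (hc.stronglyMeasurableAtFilter _ _) hc.continuousAt).const_add _
  rw [projIcc_of_mem hab ⟨ht.1, ht.2.le⟩] at h1
  refine h1.hasDerivWithinAt.congr_of_eventuallyEq ?_ (hint t ⟨ht.1, ht.2.le⟩)
  filter_upwards [Ico_mem_nhdsGE ht.2] with s hs
  exact hint s ⟨ht.1.trans hs.1, hs.2.le⟩

/-- Uniqueness: Gronwall's inequality shows that the set of times at which two solutions agree can
be enlarged to the right of each of its points. -/
theorem RightSol.eqOn {G : ℝ → E → E} (hL : LocLipschitz G) {a b : ℝ} {α β : ℝ → E}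
    (hα : RightSol G a b α) (hβ : RightSol G a b β) (h0 : α a = β a) :
    EqOn α β (Icc a b) := by
  intro t ht
  have hclosed : IsClosed ({s | α s = β s} ∩ Icc a b) := by
    rw [inter_comm]
    have h := (hα.cont.sub hβ.cont).preimage_isClosed_of_isClosed isClosed_Icc
      (isClosed_singleton (x := (0 : E)))
    simpa [Set.preimage, sub_eq_zero] using h
  refine hclosed.Icc_subset_of_forall_mem_nhdsWithin h0 ?_ ht
  rintro x ⟨hx, hxab⟩
  obtain ⟨δ, hδ, K, hK⟩ := hL x (α x)
  have hxI : x ∈ Icc a b := ⟨hxab.1, hxab.2.le⟩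
  have near : ∀ γ : ℝ → E, RightSol G a b γ → γ x = α x →
      ∀ᶠ s in 𝓝[≥] x, γ s ∈ Metric.ball (α x) δ := by
    intro γ hγ hγx
    have h1 : ContinuousWithinAt γ (Ici x) x :=
      (hγ.deriv x hxab).continuousWithinAt
    have := h1.eventually (Metric.ball_mem_nhds _ hδ)
    rwa [hγx] at this
  have hx2 : β x = α x := hx.symm
  have hev := (((near α hα rfl).and (near β hβ hx2)).and (Ico_mem_nhdsGE hxab.2)).and
    (mem_nhdsWithin_of_mem_nhds (Metric.ball_mem_nhds x hδ))
  obtain ⟨u, hu, hsub⟩ := (mem_nhdsGE_iff_exists_Icc_subset (a := x)).1 hev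
  have hux : x < u := hu
  have hub : u ≤ b := (hsub ⟨hux.le, le_rfl⟩).1.2.2.le
  have key := ODE_solution_unique_of_mem_Icc_right (v := G) (K := K)
    (s := fun _ => Metric.ball (α x) δ) (a := x) (b := u) (f := α) (g := β)
    (fun s hs => hK s (by simpa [Real.dist_eq] using (hsub ⟨hs.1, hs.2.le⟩).2))
    (hα.mono hxab.1 hub).cont (hα.mono hxab.1 hub).deriv
    (fun s hs => (hsub ⟨hs.1, hs.2.le⟩).1.1.1)
    (hβ.mono hxab.1 hub).cont (hβ.mono hxab.1 hub).deriv
    (fun s hs => (hsub ⟨hs.1, hs.2.le⟩).1.1.2) hx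
  filter_upwards [Ioo_mem_nhdsGT hux] with s hs
  exact key ⟨hs.1.le, hs.2.le⟩

/-- Local solvability to the right of any point. -/
theorem exists_local_rightSol [CompleteSpace E] {G : ℝ → E → E}
    (hG : Continuous fun p : ℝ × E => G p.1 p.2) (hL : LocLipschitz G) (s : ℝ) (w : E) :
    ∃ ε > 0, ∃ β : ℝ → E, β s = w ∧ RightSol G s (s + ε) β := by
  obtain ⟨δ, hδ, K, hK⟩ := hL s w
  have hcont : ∀ᶠ p : ℝ × E in 𝓝 (s, w), ‖G p.1 p.2‖ < ‖G s w‖ + 1 :=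
    (hG.norm.continuousAt (x := (s, w))).eventually_lt continuousAt_const (by simp)
  obtain ⟨ρ, hρ, hball⟩ := Metric.eventually_nhds_iff_ball.1 hcont
  set L : NNReal := ⟨‖G s w‖ + 1, by positivity⟩
  set r : NNReal := ⟨min δ ρ / 2, by positivity⟩ with hr
  have hr0 : 0 < min δ ρ := lt_min hδ hρ
  have hLpos : (0 : ℝ) < ‖G s w‖ + 1 := by positivity
  set ε : ℝ := min (min δ ρ / 2) (min δ ρ / 2 / (‖G s w‖ + 1)) with hε
  have hε0 : 0 < ε := by positivity
  have hε1 : ε ≤ min δ ρ / 2 := min_le_left _ _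
  have hε2 : ε ≤ min δ ρ / 2 / (‖G s w‖ + 1) := min_le_right _ _
  have ht : ∀ t ∈ Icc s (s + ε), |t - s| ≤ ε := fun t ht => by
    rw [abs_of_nonneg (by linarith [ht.1])]; linarith [ht.2]
  have hm1 : min δ ρ ≤ δ := min_le_left _ _
  have hm2 : min δ ρ ≤ ρ := min_le_right _ _
  have hpl : IsPicardLindelof G (tmin := s) (tmax := s + ε) ⟨s, by simp [hε0.le]⟩ w r 0 L K := by
    refine ⟨fun t h => ?_, fun x _ => ?_, fun t h x hx => ?_, ?_⟩
    · refine (hK t ((ht t h).trans_lt (by linarith))).mono ?_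
      refine Metric.closedBall_subset_ball ?_
      change min δ ρ / 2 < δ
      linarith
    · exact (hG.comp (continuous_id.prodMk continuous_const)).continuousOn
    · refine (hball (t, x) ?_).le
      rw [Metric.mem_ball, Prod.dist_eq]
      refine max_lt ?_ ?_
      · rw [Real.dist_eq]; exact (ht t h).trans_lt (by linarith)
      · have : dist x w ≤ min δ ρ / 2 := hx
        change dist x w < ρ
        linarith
    · change (‖G s w‖ + 1) * max (s + ε - s) (s - s) ≤ min δ ρ / 2 - 0
      rw [sub_self, add_sub_cancel_left, max_eq_left hε0.le, sub_zero, mul_comm]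
      exact (le_div_iff₀ hLpos).1 hε2
  obtain ⟨β, hβ0, hβ⟩ := hpl.exists_eq_forall_mem_Icc_hasDerivWithinAt₀
  refine ⟨ε, hε0, β, hβ0, fun t h => (hβ t h).continuousWithinAt, fun t h => ?_⟩
  exact (hβ t ⟨h.1, h.2.le⟩).mono_of_mem_nhdsWithin
    (mem_of_superset (Icc_mem_nhdsGE h.2) (Icc_subset_Icc_left h.1))

theorem RightSol.glue {G : ℝ → E → E} {a b c : ℝ} {α β : ℝ → E} (hab : a ≤ b) (hbc : b ≤ c)
    (hα : RightSol G a b α) (hβ : RightSol G b c β) (h : α b = β b) :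
    RightSol G a c (fun t => if t ≤ b then α t else β t) := by
  set γ : ℝ → E := fun t => if t ≤ b then α t else β t with hγ
  have e1 : ∀ t ≤ b, γ t = α t := fun t ht => if_pos ht
  have e2 : ∀ t, b ≤ t → γ t = β t := fun t ht => by
    rcases ht.eq_or_lt with rfl | h'
    · rw [e1 _ le_rfl, h]
    · exact if_neg h'.not_ge
  constructor
  · rw [← Icc_union_Icc_eq_Icc hab hbc]
    exact (hα.cont.congr fun t ht => e1 t ht.2).union_of_isClosed
      (hβ.cont.congr fun t ht => e2 t ht.1) isClosed_Icc isClosed_Icc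
  · intro t ht
    rcases lt_or_ge t b with htb | htb
    · rw [e1 t htb.le]
      refine (hα.deriv t ⟨ht.1, htb⟩).congr_of_eventuallyEq ?_ (e1 t htb.le)
      filter_upwards [Ico_mem_nhdsGE htb] with s hs using e1 s hs.2.le
    · rw [e2 t htb]
      exact (hβ.deriv t ⟨htb, ht.2⟩).congr (fun s hs => e2 s (htb.trans hs)) (e2 t htb)

/-- The union of solutions on all `[a, s]`, `s < b`, extends continuously to `[a, b]` when it is
bounded and `G` is bounded on bounded sets, because it is then Lipschitz. -/
theorem exists_rightSol_of_forall_lt [CompleteSpace E] {G : ℝ → E → E}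
    (hL : LocLipschitz G) {a b : ℝ} (hab : a < b)
    {w : E} {C : ℝ}
    (h : ∀ s ∈ Ico a b, ∃ α : ℝ → E, α a = w ∧ RightSol G a s α)
    (hC : ∀ s ∈ Ico a b, ∀ α : ℝ → E, α a = w → RightSol G a s α → ∀ t ∈ Icc a s,
      ‖G t (α t)‖ ≤ C) :
    ∃ α : ℝ → E, α a = w ∧ RightSol G a b α := by
  choose! A hA0 hA using h
  have hEq : ∀ s ∈ Ico a b, ∀ t ∈ Icc a s, A t t = A s t := fun s hs t ht => by
    have htb : t ∈ Ico a b := ⟨ht.1, ht.2.trans_lt hs.2⟩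
    exact RightSol.eqOn hL (hA t htb) ((hA s hs).mono le_rfl ht.2)
      ((hA0 t htb).trans (hA0 s hs).symm) ⟨ht.1, le_rfl⟩
  have hderiv : ∀ t ∈ Ico a b, HasDerivWithinAt (fun t => A t t) (G t (A t t)) (Ici t) t := by
    intro t ht
    obtain ⟨s, hts, hsb⟩ := exists_between ht.2
    have hs : s ∈ Ico a b := ⟨ht.1.trans hts.le, hsb⟩
    have := (hA s hs).deriv t ⟨ht.1, hts⟩
    rw [hEq s hs t ⟨ht.1, hts.le⟩]
    refine this.congr_of_eventuallyEq ?_ (hEq s hs t ⟨ht.1, hts.le⟩)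
    filter_upwards [Ico_mem_nhdsGE hts] with u hu using hEq s hs u ⟨ht.1.trans hu.1, hu.2.le⟩
  have hC0 : 0 ≤ C := (norm_nonneg _).trans
    (hC a ⟨le_rfl, hab⟩ _ (hA0 a ⟨le_rfl, hab⟩) (hA a ⟨le_rfl, hab⟩) a ⟨le_rfl, le_rfl⟩)
  have hlip : LipschitzOnWith ⟨C, hC0⟩ (fun t => A t t) (Ico a b) := by
    refine LipschitzOnWith.of_dist_le_mul fun x hx y hy => ?_
    have main : ∀ x ∈ Ico a b, ∀ y ∈ Ico a b, x ≤ y → dist (A x x) (A y y) ≤ C * dist x y := by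
      intro x hx y hy hxy
      rw [hEq y hy x ⟨hx.1, hxy⟩, dist_comm, dist_eq_norm, dist_comm x y, Real.dist_eq,
        abs_of_nonneg (sub_nonneg.2 hxy)]
      exact norm_image_sub_le_of_norm_deriv_right_le_segment
        ((hA y hy).mono hx.1 le_rfl).cont ((hA y hy).mono hx.1 le_rfl).deriv
        (fun t ht => hC y hy _ (hA0 y hy) (hA y hy) t ⟨hx.1.trans ht.1, ht.2.le⟩) y ⟨hxy, le_rfl⟩
    rcases le_total x y with hxy | hxy
    · exact main x hx y hy hxy
    · rw [dist_comm, dist_comm x y]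
      exact main y hy x hx hxy
  have : (𝓝[<] b).NeBot := nhdsLT_neBot_of_exists_lt ⟨a, hab⟩
  have hcauchy : Cauchy (map (fun t => A t t) (𝓝[<] b)) :=
    ((cauchy_nhds (a := b)).mono' this inf_le_left).map_of_le hlip.uniformContinuousOn
      (le_principal_iff.2 (Ico_mem_nhdsLT hab))
  obtain ⟨l, hl⟩ := CompleteSpace.complete hcauchy
  have hne : ∀ t ∈ Ico a b, Function.update (fun t => A t t) b l t = A t t := fun t ht =>
    Function.update_of_ne ht.2.ne _ _
  refine ⟨Function.update (fun t => A t t) b l, ?_, ?_, fun t ht => ?_⟩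
  · rw [hne a ⟨le_rfl, hab⟩, hA0 a ⟨le_rfl, hab⟩]
  · rw [continuousOn_update_iff]
    have hd : Icc a b \ {b} = Ico a b := by ext; simp
    rw [hd]
    exact ⟨hlip.continuousOn, fun _ => 
      Tendsto.mono_left hl (nhdsWithin_mono _ Ico_subset_Iio_self)⟩
  · rw [hne t ht]
    refine (hderiv t ht).congr_of_eventuallyEq ?_ (hne t ht)
    filter_upwards [Ico_mem_nhdsGE ht.2] with s hs using hne s ⟨ht.1.trans hs.1, hs.2⟩

/-- **Continuation principle.** If `G` is bounded on bounded sets, then an a priori bound for the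
solutions on bounded time intervals gives a solution on every `[a, b]`. -/
theorem exists_rightSol_of_bounded [CompleteSpace E] {G : ℝ → E → E}
    (hG : Continuous fun p : ℝ × E => G p.1 p.2) (hL : LocLipschitz G) {a b : ℝ} (hab : a ≤ b)
    {w : E} {C : ℝ}
    (hC : ∀ s ∈ Icc a b, ∀ α : ℝ → E, α a = w → RightSol G a s α → ∀ t ∈ Icc a s,
      ‖G t (α t)‖ ≤ C) :
    ∃ α : ℝ → E, α a = w ∧ RightSol G a b α := by
  set Z : Set ℝ := {s | ∃ α : ℝ → E, α a = w ∧ RightSol G a s α}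
  have hmono : ∀ s ∈ Z, ∀ s' ≤ s, s' ∈ Z := fun s ⟨α, h1, h2⟩ s' hs' =>
    ⟨α, h1, h2.mono le_rfl hs'⟩
  have ha : a ∈ Z := ⟨fun _ => w, rfl, by simp [continuousOn_singleton], by simp⟩
  have hclosed : IsClosed (Z ∩ Icc a b) := by
    refine IsSeqClosed.isClosed fun u s hu hus => ?_
    have hs : s ∈ Icc a b := isClosed_Icc.mem_of_tendsto hus (Eventually.of_forall fun n => (hu n).2)
    refine ⟨?_, hs⟩
    rcases hs.1.eq_or_lt with rfl | has
    · exact ha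
    refine exists_rightSol_of_forall_lt hL has (C := C) (fun r hr => ?_) fun r hr =>
      hC r ⟨hr.1, hr.2.le.trans hs.2⟩
    obtain ⟨n, hn⟩ := (hus.eventually (lt_mem_nhds hr.2)).exists
    exact hmono _ (hu n).1 r hn.le
  refine hclosed.Icc_subset_of_forall_mem_nhdsWithin ha ?_ ⟨hab, le_rfl⟩
  rintro s ⟨⟨α, h1, h2⟩, hs⟩
  obtain ⟨ε, hε, β, hβ0, hβ⟩ := exists_local_rightSol hG hL s (α s)
  have hglue : s + ε ∈ Z :=
    ⟨_, by simp [hs.1, h1], h2.glue hs.1 (by linarith) hβ hβ0.symm⟩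
  filter_upwards [Ioo_mem_nhdsGT (show s < s + ε by linarith)] with r hr
  exact hmono _ hglue r hr.2.le

/-- Global solutions from solutions on all bounded intervals. -/
theorem exists_global_of_forall_rightSol [CompleteSpace E] {G : ℝ → E → E}
    (hG : Continuous fun p : ℝ × E => G p.1 p.2) (hL : LocLipschitz G) {a : ℝ} {w : E}
    (h : ∀ b, a ≤ b → ∃ α : ℝ → E, α a = w ∧ RightSol G a b α) :
    ∃ α : ℝ → E, α a = w ∧ ∀ t, a ≤ t → HasDerivAt α (G t (α t)) t := by
  choose! A hA0 hA using h
  have hEq : ∀ b, a ≤ b → ∀ t ∈ Icc a b, A t t = A b t := fun b hb t ht =>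
    RightSol.eqOn hL (hA t ht.1) ((hA b hb).mono le_rfl ht.2)
      ((hA0 t ht.1).trans (hA0 b hb).symm) ⟨ht.1, le_rfl⟩
  have hcont : ContinuousOn (fun t => A t t) (Ici a) := by
    intro t ht
    have ht1 : t ∈ Icc a (t + 1) := ⟨ht, by linarith⟩
    have h1 : ContinuousWithinAt (A (t + 1)) (Ici a) t :=
      ((hA (t + 1) (by linarith [ht1.1])).cont t ht1).mono_of_mem_nhdsWithin <| by
        rw [← Ici_inter_Iic]
        exact inter_mem self_mem_nhdsWithin
          (mem_nhdsWithin_of_mem_nhds (Iic_mem_nhds (by linarith)))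
    refine h1.congr_of_eventuallyEq ?_ (hEq (t + 1) (by linarith [ht1.1]) t ht1)
    filter_upwards [self_mem_nhdsWithin,
      mem_nhdsWithin_of_mem_nhds (Iic_mem_nhds (show t < t + 1 by linarith))] with s hs1 hs2
    exact hEq (t + 1) (by linarith [ht1.1]) s ⟨hs1, hs2⟩
  set g : ℝ → E := fun s => G s (A (max a s) (max a s)) with hg
  have hgc : Continuous g := by
    refine hG.comp (continuous_id.prodMk ?_)
    exact hcont.comp_continuous (continuous_const.max continuous_id) fun s => le_max_left a s
  have hint : ∀ t, a ≤ t → A t t = w + ∫ s in a..t, g s := by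
    intro t ht
    rw [eq_add_integral_of_hasDerivWithinAt hG ht (hA t ht).cont
      (fun s hs => ((hA t ht).deriv s ⟨hs.1.le, hs.2⟩).mono Ioi_subset_Ici_self) t ⟨ht, le_rfl⟩,
      hA0 t ht]
    congr 1
    refine intervalIntegral.integral_congr fun s hs => ?_
    rw [uIcc_of_le ht] at hs
    simp only [hg]
    rw [projIcc_of_mem ht hs, max_eq_right hs.1, hEq t ht s hs]
  refine ⟨fun t => w + ∫ s in a..t, g s, by simp, fun t ht => ?_⟩
  have h1 : HasDerivAt (fun t => w + ∫ s in a..t, g s) (g t) t :=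
    (intervalIntegral.integral_hasDerivAt_right (hgc.intervalIntegrable _ _)
      (hgc.stronglyMeasurableAtFilter _ _) hgc.continuousAt).const_add _
  have h2 : g t = G t (w + ∫ s in a..t, g s) := by
    rw [← hint t ht]; simp only [hg]; rw [max_eq_right ht]
  rwa [h2] at h1

end ODE

/-! ### Comparison with a scalar equation: an a priori bound -/

section Comparison

variable {E : Type*} [NormedAddCommGroup E] [NormedSpace ℝ E]

/-- Where the solution stays in the region in which `V` is Lipschitz, the growth condition bounds
the increase of `Φ(V(α))`, `Φ' = 1 / (U + ε)`, by the integral of `l ψ`. The shift by `ε > 0` makes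
the right-hand side uniformly smaller than `1 / U` near each point, so that `Φ(V(α t)) - l ∫ ψ` is
seen to be locally nonincreasing without differentiating `V ∘ α`. -/
theorem integral_inv_comp_le [CompleteSpace E] {G : ℝ → E → E}
    (hG : Continuous fun p : ℝ × E => G p.1 p.2) {a b : ℝ} (hab : a ≤ b) {α : ℝ → E}
    (hα : RightSol G a b α) {V : E → ℝ} (hV : Continuous V) {l : ℝ} (hl : 0 ≤ l)
    (hVl : ∀ s ∈ Icc a b, ∀ t ∈ Icc a b, |V (α s) - V (α t)| ≤ l * ‖α s - α t‖)
    {U ψ : ℝ → ℝ} (hU : Continuous U) (hU0 : ∀ u, 0 ≤ U u)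
    (hψ0 : ∀ t ∈ Icc a b, 0 ≤ ψ t) (hψ : IntegrableOn ψ (Icc a b))
    (hgrow : ∀ t ∈ Icc a b, ‖G t (α t)‖ ≤ U (V (α t)) * ψ t) {ε : ℝ} (hε : 0 < ε) (v₀ : ℝ) :
    ∫ u in v₀..V (α b), (U u + ε)⁻¹ ≤ (∫ u in v₀..V (α a), (U u + ε)⁻¹) + l * ∫ t in a..b, ψ t := by
  set φ : ℝ → ℝ := fun u => (U u + ε)⁻¹
  have hpos : ∀ u, 0 < U u + ε := fun u => add_pos_of_nonneg_of_pos (hU0 u) hε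
  have hφc : Continuous φ := (hU.add continuous_const).inv₀ fun u => (hpos u).ne'
  have hφi : ∀ x y, IntervalIntegrable φ volume x y := fun x y => hφc.intervalIntegrable x y
  have hψi : ∀ x ∈ Icc a b, ∀ y ∈ Icc a b, x ≤ y → IntervalIntegrable ψ volume x y :=
    fun x hx y hy hxy => by
      rw [intervalIntegrable_iff_integrableOn_Icc_of_le hxy]
      exact hψ.mono_set (Icc_subset_Icc hx.1 hy.2)
  have hVα : ContinuousOn (fun t => V (α t)) (Icc a b) := hV.comp_continuousOn hα.cont
  set h : ℝ → ℝ := fun t => ∫ u in v₀..V (α t), φ u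
  have hhc : ContinuousOn h (Icc a b) :=
    (intervalIntegral.continuous_primitive hφi v₀).comp_continuousOn hVα
  have hΨc : ContinuousOn (fun t => ∫ s in a..t, ψ s) (Icc a b) :=
    intervalIntegral.continuousOn_primitive_interval (by rwa [uIcc_of_le hab]) |>.mono
      (by rw [uIcc_of_le hab])
  have hclosed : IsClosed ({t | h t ≤ h a + l * ∫ s in a..t, ψ s} ∩ Icc a b) := by
    have := isClosed_Icc.isClosed_le hhc (continuousOn_const.add (continuousOn_const.mul hΨc))
      (f := h) (g := fun t => h a + l * ∫ s in a..t, ψ s)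
    convert this using 1
    ext t; simp [and_comm]
  refine hclosed.Icc_subset_of_forall_mem_nhdsWithin (by simp) ?_ ⟨hab, le_rfl⟩
  rintro x ⟨hx, hxab⟩
  have hxI : x ∈ Icc a b := ⟨hxab.1, hxab.2.le⟩
  set c : ℝ := U (V (α x)) + ε / 2 with hc
  have hc0 : 0 < c := by have := hU0 (V (α x)); positivity
  obtain ⟨ρ, hρ, hρU⟩ := Metric.eventually_nhds_iff_ball.1
    ((hU.continuousAt (x := V (α x))).eventually (Metric.ball_mem_nhds _ (half_pos hε)))
  have hnear : ∀ᶠ s in 𝓝[≥] x, V (α s) ∈ Metric.ball (V (α x)) ρ :=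
    ((hVα x hxI).mono_of_mem_nhdsWithin
      (mem_of_superset (Icc_mem_nhdsGE hxab.2) (Icc_subset_Icc_left hxab.1))).eventually
      (Metric.ball_mem_nhds _ hρ)
  obtain ⟨y, hy, hsub⟩ := (mem_nhdsGE_iff_exists_Icc_subset (a := x)).1
    (hnear.and (Ico_mem_nhdsGE hxab.2))
  have hxy : x < y := hy
  filter_upwards [Ioo_mem_nhdsGT hxy] with s hs
  have hxs : x ≤ s := hs.1.le
  have hsI : s ∈ Icc a b := ⟨hxI.1.trans hxs, (hsub ⟨hxs, hs.2.le⟩).2.2.le⟩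
  have hUlt : ∀ u ∈ Metric.ball (V (α x)) ρ, |U u - U (V (α x))| < ε / 2 := fun u hu => by
    have := hρU u hu; rwa [Real.dist_eq] at this
  have hnorm : ‖α s - α x‖ ≤ c * ∫ t in x..s, ψ t := by
    have hsol := hα.mono hxI.1 hsI.2
    rw [eq_add_integral_of_hasDerivWithinAt hG hxs hsol.cont
      (fun t ht => (hsol.deriv t ⟨ht.1.le, ht.2⟩).mono Ioi_subset_Ici_self) s ⟨hxs, le_rfl⟩,
      add_sub_cancel_left, ← intervalIntegral.integral_const_mul]
    refine intervalIntegral.norm_integral_le_of_norm_le hxs (Eventually.of_forall fun t ht => ?_)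
      ((hψi x hxI s hsI hxs).const_mul c)
    have htI : t ∈ Icc a b := ⟨hxI.1.trans ht.1.le, ht.2.trans hsI.2⟩
    rw [projIcc_of_mem hxs ⟨ht.1.le, ht.2⟩]
    refine (hgrow t htI).trans (mul_le_mul_of_nonneg_right ?_ (hψ0 t htI))
    have := abs_lt.1 (hUlt _ (hsub ⟨ht.1.le, ht.2.trans hs.2.le⟩).1)
    linarith [this.2]
  have hinc : h s - h x ≤ l * ∫ t in x..s, ψ t := by
    have e1 : h s - h x = ∫ u in V (α x)..V (α s), φ u :=
      intervalIntegral.integral_interval_sub_left (hφi _ _) (hφi _ _)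
    have e2 : ‖∫ u in V (α x)..V (α s), φ u‖ ≤ c⁻¹ * |V (α s) - V (α x)| := by
      refine intervalIntegral.norm_integral_le_of_norm_le_const fun u hu => ?_
      have hu' : u ∈ Metric.ball (V (α x)) ρ := by
        have hsx := (hsub ⟨hxs, hs.2.le⟩).1
        rw [Metric.mem_ball, Real.dist_eq] at hsx ⊢
        have := Set.abs_sub_left_of_mem_uIcc (uIoc_subset_uIcc hu)
        rw [abs_sub_comm] at this
        rw [abs_sub_comm (V (α s))] at hsx
        rw [abs_sub_comm]
        have h3 := abs_sub_comm (V (α x)) (V (α s))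
        have h4 := abs_sub_comm (V (α x)) u
        linarith
      rw [Real.norm_of_nonneg (inv_nonneg.2 (hpos u).le)]
      refine inv_anti₀ hc0 ?_
      have := abs_lt.1 (hUlt u hu')
      linarith [this.1]
    have e3 := (hVl s hsI x hxI).trans (mul_le_mul_of_nonneg_left hnorm hl)
    calc h s - h x ≤ ‖∫ u in V (α x)..V (α s), φ u‖ := by rw [e1]; exact le_abs_self _
      _ ≤ c⁻¹ * (l * (c * ∫ t in x..s, ψ t)) := e2.trans (by gcongr)
      _ = l * ∫ t in x..s, ψ t := by field_simp
  have hadd : (∫ t in a..x, ψ t) + ∫ t in x..s, ψ t = ∫ t in a..s, ψ t :=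
    intervalIntegral.integral_add_adjacent_intervals (hψi a ⟨le_rfl, hab⟩ x hxI hxI.1)
      (hψi x hxI s hsI hxs)
  have hx' : h x ≤ h a + l * ∫ s in a..x, ψ s := hx
  change h s ≤ h a + l * ∫ t in a..s, ψ t
  rw [← hadd, mul_add]
  linarith

/-- If `∫ du / U(u)` diverges at infinity (with `1 / 0 = ∞`), then the integrals of `1 / (U + ε)`
over bounded intervals become arbitrarily large. -/
theorem exists_lt_integral_inv_add {U : ℝ → ℝ} (hU : Continuous U) (hU0 : ∀ u, 0 ≤ U u) {v₀ : ℝ}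
    (hdiv : ∫⁻ u in Ioi v₀, (ENNReal.ofReal (U u))⁻¹ = ⊤) (I : ℝ) :
    ∃ ε > 0, ∃ N, v₀ ≤ N ∧ I < ∫ u in v₀..N, (U u + ε)⁻¹ := by
  set F : ℕ → ℝ → ENNReal := fun n => (Iic (n : ℝ)).indicator
    fun u => (ENNReal.ofReal (U u + 1 / ((n : ℝ) + 1)))⁻¹ with hF
  have hcn : ∀ n : ℕ, Continuous fun u => (ENNReal.ofReal (U u + 1 / ((n : ℝ) + 1)))⁻¹ := fun n =>
    (ENNReal.continuous_ofReal.comp (hU.add continuous_const)).inv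
  have hFm : ∀ n, Measurable (F n) := fun n => (hcn n).measurable.indicator measurableSet_Iic
  have hmono : ∀ u, Monotone fun n => F n u := by
    intro u n m hnm
    have hnm' : (n : ℝ) ≤ m := Nat.cast_le.2 hnm
    simp only [hF, indicator_apply, mem_Iic]
    split_ifs with h1 h2
    · refine ENNReal.inv_le_inv.2 (ENNReal.ofReal_le_ofReal ?_)
      gcongr
    · exact absurd (h1.trans hnm') h2
    · exact zero_le
    · exact le_rfl
  have hlim : ∀ u, Tendsto (fun n => F n u) atTop (𝓝 (ENNReal.ofReal (U u))⁻¹) := by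
    intro u
    have h1 : Tendsto (fun n : ℕ => (ENNReal.ofReal (U u + 1 / ((n : ℝ) + 1)))⁻¹) atTop
        (𝓝 (ENNReal.ofReal (U u))⁻¹) := by
      refine (ENNReal.tendsto_ofReal ?_).inv
      simpa using tendsto_const_nhds.add (tendsto_one_div_add_atTop_nhds_zero_nat (𝕜 := ℝ))
    refine h1.congr' ?_
    filter_upwards [tendsto_natCast_atTop_atTop.eventually_ge_atTop u] with n hn
    simp only [hF]
    rw [indicator_of_mem (show u ∈ Iic (n : ℝ) from hn)]
  have hten := lintegral_tendsto_of_tendsto_of_monotone (μ := volume.restrict (Ioi v₀))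
    (fun n => (hFm n).aemeasurable) (Eventually.of_forall hmono) (Eventually.of_forall hlim)
  rw [hdiv] at hten
  obtain ⟨n, hn, hnv⟩ := ((hten.eventually (lt_mem_nhds (ENNReal.ofReal_lt_top (r := I)))).and
    (tendsto_natCast_atTop_atTop.eventually_ge_atTop v₀)).exists
  have hε : (0 : ℝ) < 1 / ((n : ℝ) + 1) := by positivity
  refine ⟨1 / ((n : ℝ) + 1), hε, n, hnv, ?_⟩
  have hpos : ∀ u, 0 < U u + 1 / ((n : ℝ) + 1) := fun u => add_pos_of_nonneg_of_pos (hU0 u) hε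
  have hc : Continuous fun u => (U u + 1 / ((n : ℝ) + 1))⁻¹ :=
    (hU.add continuous_const).inv₀ fun u => (hpos u).ne'
  have key : ∫⁻ u in Ioi v₀, F n u =
      ENNReal.ofReal (∫ u in v₀..n, (U u + 1 / ((n : ℝ) + 1))⁻¹) := by
    rw [intervalIntegral.integral_of_le hnv, ofReal_integral_eq_lintegral_ofReal
      ((hc.integrableOn_Icc (a := v₀) (b := n)).mono_set Ioc_subset_Icc_self)
      (Eventually.of_forall fun u => inv_nonneg.2 (hpos u).le)]
    simp only [hF]
    rw [lintegral_indicator measurableSet_Iic, Measure.restrict_restrict measurableSet_Iic,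
      inter_comm, Ioi_inter_Iic]
    refine lintegral_congr fun u => ?_
    rw [ENNReal.ofReal_inv_of_pos (hpos u)]
  rw [key] at hn
  exact (ENNReal.ofReal_lt_ofReal_iff'.1 hn).1

/-- **A priori bound.** If `V` is Lipschitz outside a ball, tends to infinity, and the right-hand
side is dominated there by `U(V) ψ`, where `v' = U(v) ψ(t)` has no blow-up, then all solutions with
a given initial value are bounded on bounded time intervals by a common constant. -/
theorem exists_norm_le_of_growth [CompleteSpace E] {G : ℝ → E → E}
    (hG : Continuous fun p : ℝ × E => G p.1 p.2) {R : ℝ} {V : E → ℝ} (hV : Continuous V)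
    (hV0 : ∀ w, 0 ≤ V w) (hVt : Tendsto V (comap norm atTop) atTop) {l : ℝ} (hl : 0 ≤ l)
    (hVl : ∀ w₁ w₂ : E, R ≤ ‖w₁‖ → R ≤ ‖w₂‖ → |V w₁ - V w₂| ≤ l * ‖w₁ - w₂‖)
    {U ψ : ℝ → ℝ} (hU : ContinuousOn U (Ici 0)) (hU0 : ∀ u, 0 ≤ u → 0 ≤ U u)
    (hψ0 : ∀ t, 0 ≤ t → 0 ≤ ψ t) (hψ : ∀ T, 0 ≤ T → IntegrableOn ψ (Icc 0 T))
    (hdiv : ∀ u₀ > (0 : ℝ), ∫⁻ u in Ioi u₀, (ENNReal.ofReal (U u))⁻¹ = ⊤)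
    (hgrow : ∀ t, 0 ≤ t → ∀ w, R ≤ ‖w‖ → ‖G t w‖ ≤ U (V w) * ψ t)
    {a b : ℝ} (ha : 0 ≤ a) (hab : a ≤ b) (w : E) :
    ∃ M, ∀ s ∈ Icc a b, ∀ α : ℝ → E, α a = w → RightSol G a s α → ∀ t ∈ Icc a s, ‖α t‖ ≤ M := by
  obtain ⟨C, hC⟩ : ∃ C, ∀ z : E, ‖z‖ = R → V z ≤ C := by
    by_cases h : ∃ z : E, ‖z‖ = R
    · obtain ⟨z₁, hz₁⟩ := h
      refine ⟨V z₁ + l * (R + R), fun z hz => ?_⟩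
      have h1 := (abs_le.1 (hVl z z₁ hz.ge hz₁.ge)).2
      have h2 : ‖z - z₁‖ ≤ R + R := (norm_sub_le z z₁).trans_eq (by rw [hz, hz₁])
      have := mul_le_mul_of_nonneg_left h2 hl
      linarith
    · exact ⟨0, fun z hz => absurd ⟨z, hz⟩ h⟩
  set v₀ : ℝ := max 1 (max (V w) C)
  have hv₀1 : 1 ≤ v₀ := le_max_left _ _
  have hv₀w : V w ≤ v₀ := (le_max_left _ _).trans (le_max_right _ _)
  have hv₀C : C ≤ v₀ := (le_max_right _ _).trans (le_max_right _ _)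
  -- `V` is nonnegative, so `U` may be replaced by a function that is continuous on the whole line.
  set U₁ : ℝ → ℝ := fun u => U (max 0 u) with hU₁
  have hU₁c : Continuous U₁ :=
    hU.comp_continuous (continuous_const.max continuous_id) fun u => le_max_left 0 u
  have hU₁0 : ∀ u, 0 ≤ U₁ u := fun u => hU0 _ (le_max_left _ _)
  have hdiv₁ : ∫⁻ u in Ioi v₀, (ENNReal.ofReal (U₁ u))⁻¹ = ⊤ := by
    rw [← hdiv v₀ (by linarith)]
    refine setLIntegral_congr_fun measurableSet_Ioi fun u hu => ?_
    have : (0 : ℝ) ≤ u := by have : v₀ < u := hu; linarith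
    simp only [hU₁, max_eq_right this]
  obtain ⟨ε, hε, N, hN, hlt⟩ := exists_lt_integral_inv_add hU₁c hU₁0 hdiv₁ (l * ∫ t in (0)..b, ψ t)
  obtain ⟨M, hM⟩ : ∃ M, ∀ z : E, M ≤ ‖z‖ → N < V z := by
    have := hVt.eventually_gt_atTop N
    rw [eventually_comap] at this
    obtain ⟨M, hM⟩ := eventually_atTop.1 this
    exact ⟨M, fun z hz => hM _ hz z rfl⟩
  refine ⟨max R M, fun s hs α hα0 hα t₁ ht₁ => ?_⟩
  by_contra! hcon
  have hRt : R < ‖α t₁‖ := (le_max_left _ _).trans_lt hcon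
  have hNt : N < V (α t₁) := hM _ ((le_max_right _ _).trans hcon.le)
  have hVα : ContinuousOn (fun t => V (α t)) (Icc a t₁) :=
    hV.comp_continuousOn (hα.cont.mono (Icc_subset_Icc_right ht₁.2))
  have hnα : ContinuousOn (fun t => ‖α t‖) (Icc a t₁) :=
    (hα.cont.mono (Icc_subset_Icc_right ht₁.2)).norm
  -- the last time at which the solution is inside the ball or below the level `v₀`
  set B : Set ℝ := {t ∈ Icc a t₁ | V (α t) ≤ v₀} ∪ {t ∈ Icc a t₁ | ‖α t‖ ≤ R}
  have hBcl : IsClosed B := (isClosed_Icc.isClosed_le hVα continuousOn_const).union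
    (isClosed_Icc.isClosed_le hnα continuousOn_const)
  have hBsub : B ⊆ Icc a t₁ := union_subset (fun t h => h.1) fun t h => h.1
  have hBc : IsCompact B := isCompact_Icc.of_isClosed_subset hBcl hBsub
  have hBa : a ∈ B := Or.inl ⟨⟨le_rfl, ht₁.1⟩, by rw [hα0]; exact hv₀w⟩
  set τ := sSup B
  have hτB : τ ∈ B := hBc.sSup_mem ⟨a, hBa⟩
  have hτI := hBsub hτB
  have hafter : ∀ t ∈ Ioc τ t₁, v₀ < V (α t) ∧ R < ‖α t‖ := by
    intro t ht
    have htI : t ∈ Icc a t₁ := ⟨hτI.1.trans ht.1.le, ht.2⟩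
    have htB : t ∉ B := fun h => absurd (le_csSup hBc.bddAbove h) (not_le.2 ht.1)
    refine ⟨?_, ?_⟩
    · by_contra! h; exact htB (Or.inl ⟨htI, h⟩)
    · by_contra! h; exact htB (Or.inr ⟨htI, h⟩)
  have hτne : τ < t₁ := by
    refine lt_of_le_of_ne hτI.2 fun h => ?_
    rcases hτB with ⟨-, h1⟩ | ⟨-, h1⟩
    · rw [h] at h1; linarith
    · rw [h] at h1; linarith
  have hτR : R ≤ ‖α τ‖ := by
    have hcl : τ ∈ closure (Ioc τ t₁) := by
      rw [closure_Ioc hτne.ne]; exact ⟨le_rfl, hτne.le⟩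
    have hc : ContinuousWithinAt (fun t => ‖α t‖) (Ioc τ t₁) τ :=
      (hnα τ hτI).mono fun t ht => ⟨hτI.1.trans ht.1.le, ht.2⟩
    exact closure_minimal (s := (fun t => ‖α t‖) '' Ioc τ t₁) (t := Ici R)
      (by rintro _ ⟨t, ht, rfl⟩; exact (hafter t ht).2.le) isClosed_Ici (hc.mem_closure_image hcl)
  have hτV : V (α τ) ≤ v₀ := by
    rcases hτB with ⟨-, h1⟩ | ⟨-, h1⟩
    · exact h1
    · exact (hC _ (le_antisymm h1 hτR)).trans hv₀C
  have hRall : ∀ t ∈ Icc τ t₁, R ≤ ‖α t‖ := by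
    intro t ht
    rcases ht.1.eq_or_lt with rfl | h
    · exact hτR
    · exact (hafter t ⟨h, ht.2⟩).2.le
  have hτ0 : 0 ≤ τ := ha.trans hτI.1
  have ht₁b : t₁ ≤ b := ht₁.2.trans hs.2
  have hest := integral_inv_comp_le hG hτne.le (hα.mono hτI.1 ht₁.2) hV hl
    (fun x hx y hy => hVl _ _ (hRall x hx) (hRall y hy)) hU₁c hU₁0
    (fun t ht => hψ0 t (hτ0.trans ht.1))
    ((hψ b (ha.trans hab)).mono_set (Icc_subset_Icc hτ0 ht₁b))
    (fun t ht => by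
      simp only [hU₁, max_eq_right (hV0 _)]
      exact hgrow t (hτ0.trans ht.1) _ (hRall t ht)) hε v₀
  have hpos : ∀ u, 0 ≤ (U₁ u + ε)⁻¹ := fun u => inv_nonneg.2 (add_nonneg (hU₁0 u) hε.le)
  have hφi : ∀ x y, IntervalIntegrable (fun u => (U₁ u + ε)⁻¹) volume x y := fun x y =>
    ((hU₁c.add continuous_const).inv₀ fun u =>
      (add_pos_of_nonneg_of_pos (hU₁0 u) hε).ne').intervalIntegrable x y
  have h1 : ∫ u in v₀..V (α τ), (U₁ u + ε)⁻¹ ≤ 0 := by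
    rw [intervalIntegral.integral_symm, neg_nonpos]
    exact intervalIntegral.integral_nonneg hτV fun u _ => hpos u
  have h2 : ∫ u in v₀..N, (U₁ u + ε)⁻¹ ≤ ∫ u in v₀..V (α t₁), (U₁ u + ε)⁻¹ := by
    rw [← intervalIntegral.integral_add_adjacent_intervals (hφi v₀ N) (hφi N (V (α t₁)))]
    have := intervalIntegral.integral_nonneg (μ := volume) hNt.le fun u _ => hpos u
    linarith
  have h3 : ∫ t in τ..t₁, ψ t ≤ ∫ t in (0)..b, ψ t := by
    refine intervalIntegral.integral_mono_interval hτ0 hτne.le ht₁b ?_ ?_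
    · refine (ae_restrict_iff' measurableSet_Ioc).2 (Eventually.of_forall fun t ht => hψ0 t ht.1.le)
    · rw [intervalIntegrable_iff_integrableOn_Icc_of_le (ha.trans hab)]
      exact hψ b (ha.trans hab)
  have := mul_le_mul_of_nonneg_left h3 hl
  linarith

end Comparison

/-! ### Algebra of the spectral projectors -/

namespace CanonicalSystem

section Algebra

variable {𝕜 X Y : Type*} [RCLike 𝕜] [NormedAddCommGroup X] [NormedSpace 𝕜 X]
  [NormedAddCommGroup Y] [NormedSpace 𝕜 Y] {D : Submodule 𝕜 X}
  {a b : D →ₗ[𝕜] Y} {n ν : ℕ} (S : CanonicalSystem a b n ν)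

theorem P20_apply (x : D) : S.P20 x = ∑ i, S.q i 1 (b x) • S.φ i 1 := by
  simp [P20, projTerm]

theorem P2Sigma_apply (x : D) :
    S.P2Sigma x = ∑ i, ∑ j ∈ Finset.Icc 2 (S.m i), S.q i j (b x) • S.φ i j := by
  simp [P2Sigma, projTerm]

theorem P2_apply (x : D) :
    S.P2 x = ∑ i, ∑ j ∈ Finset.Icc 1 (S.m i), S.q i j (b x) • S.φ i j := by
  simp [P2, projTerm]

theorem Q2Star_apply (y : Y) : S.Q2Star y = ∑ i, S.q i (S.m i) y • b (S.φ i (S.m i)) := by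
  simp [Q2Star, projTermY]

theorem Q2Sigma_apply (y : Y) :
    S.Q2Sigma y = ∑ i, ∑ j ∈ Finset.Ico 1 (S.m i), S.q i j y • b (S.φ i j) := by
  simp [Q2Sigma, projTermY]

theorem Q2_apply (y : Y) :
    S.Q2 y = ∑ i, ∑ j ∈ Finset.Icc 1 (S.m i), S.q i j y • b (S.φ i j) := by
  simp [Q2, projTermY]

theorem Atilde_apply (x : D) :
    S.Atilde x = a x + ∑ i, S.q i 1 (b x) • b (S.φ i (S.m i)) := by
  simp [Atilde]

theorem one_mem_Icc (i : Fin n) : 1 ∈ Finset.Icc 1 (S.m i) :=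
  Finset.mem_Icc.2 ⟨le_rfl, S.one_le_m i⟩

theorem m_mem_Icc (i : Fin n) : S.m i ∈ Finset.Icc 1 (S.m i) :=
  Finset.mem_Icc.2 ⟨S.one_le_m i, le_rfl⟩

/-- The functionals `q k l` read off the coefficients of a combination of the vectors `B (φ i j)`. -/
theorem q_sum (c : Fin n → ℕ → 𝕜) (T : Fin n → Finset ℕ) (hT : ∀ i, T i ⊆ Finset.Icc 1 (S.m i))
    {k : Fin n} {l : ℕ} (hl : l ∈ Finset.Icc 1 (S.m k)) :
    S.q k l (∑ i, ∑ j ∈ T i, c i j • b (S.φ i j)) = if l ∈ T k then c k l else 0 := by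
  rw [map_sum]
  have h1 : ∀ i, S.q k l (∑ j ∈ T i, c i j • b (S.φ i j)) =
      ∑ j ∈ T i, if i = k ∧ j = l then c i j else 0 := by
    intro i
    rw [map_sum]
    refine Finset.sum_congr rfl fun j hj => ?_
    rw [map_smul, S.biorthogonal i k j (hT i hj) l hl]
    split_ifs <;> simp
  simp_rw [h1]
  rw [Finset.sum_eq_single k]
  · simp
  · intro i _ hik
    simp [hik]
  · simp

theorem q_sum_one (c : Fin n → 𝕜) {k : Fin n} :
    S.q k 1 (∑ i, c i • b (S.φ i 1)) = c k := by
  have := S.q_sum (fun i _ => c i) (fun _ => {1}) (fun i => by simpa using S.one_le_m i)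
    (S.one_mem_Icc k)
  simpa using this

theorem q_sum_last (c : Fin n → 𝕜) {k : Fin n} :
    S.q k (S.m k) (∑ i, c i • b (S.φ i (S.m i))) = c k := by
  have := S.q_sum (fun i _ => c i) (fun i => {S.m i}) (fun i => by simpa using S.one_le_m i)
    (S.m_mem_Icc k)
  simpa using this

theorem P2_eq : S.P2 = S.P20 + S.P2Sigma := by
  ext x
  rw [LinearMap.add_apply, P2_apply, P20_apply, P2Sigma_apply, ← Finset.sum_add_distrib]
  congr 2
  ext i
  have : Finset.Icc 1 (S.m i) = insert 1 (Finset.Icc 2 (S.m i)) := by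
    ext j; have := S.one_le_m i; simp; omega
  rw [this, Finset.sum_insert (by simp)]

theorem Q2_eq : S.Q2 = S.Q2Star + S.Q2Sigma := by
  ext y
  rw [add_apply, Q2_apply, Q2Star_apply, Q2Sigma_apply,
    ← Finset.sum_add_distrib]
  refine Finset.sum_congr rfl fun i _ => ?_
  have : Finset.Icc 1 (S.m i) = insert (S.m i) (Finset.Ico 1 (S.m i)) := by
    ext j; have := S.one_le_m i; simp; omega
  rw [this, Finset.sum_insert (by simp)]

theorem P1_add_P2Sigma (x : D) : S.P1 x + S.P2Sigma x = x - S.P20 x := by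
  rw [P1, P2_eq]
  simp only [LinearMap.sub_apply, LinearMap.id_apply, LinearMap.add_apply]
  abel

theorem Q1_add_Q2Sigma_apply (y : Y) : (S.Q1 + S.Q2Sigma) y = y - S.Q2Star y := by
  rw [Q1, Q2_eq]
  simp only [add_apply, sub_apply, ContinuousLinearMap.id_apply]
  abel

theorem P1_mem (x : D) : S.P1 x ∈ S.D1 := ⟨x, rfl⟩

theorem P2Sigma_mem (x : D) : S.P2Sigma x ∈ S.D2Sigma := by
  rw [P2Sigma_apply]
  exact Submodule.sum_mem _ fun i _ => Submodule.sum_mem _ fun j hj =>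
    Submodule.smul_mem _ _ (Submodule.subset_span ⟨i, j, hj, rfl⟩)

theorem a_φ_one (i : Fin n) : a (S.φ i 1) = 0 := by
  have : S.φ i 1 ∈ LinearMap.ker a := by
    rw [← S.span_eq_ker]; exact Submodule.subset_span ⟨i, rfl⟩
  exact this

theorem a_P20 (x : D) : a (S.P20 x) = 0 := by
  simp [P20_apply, S.a_φ_one]

theorem P20_mem (x : D) : S.P20 x ∈ S.D20 := S.a_P20 x

theorem exists_coeff {u : D} (hu : u ∈ S.D20) : ∃ c : Fin n → 𝕜, u = ∑ i, c i • S.φ i 1 := by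
  have : u ∈ LinearMap.ker a := hu
  rw [← S.span_eq_ker] at this
  obtain ⟨c, hc⟩ := (Submodule.mem_span_range_iff_exists_fun 𝕜).1 this
  exact ⟨c, hc.symm⟩

theorem P20_of_mem {u : D} (hu : u ∈ S.D20) : S.P20 u = u := by
  obtain ⟨c, rfl⟩ := S.exists_coeff hu
  rw [P20_apply, map_sum]
  simp_rw [map_smul, S.q_sum_one]

theorem P2Sigma_of_mem {u : D} (hu : u ∈ S.D20) : S.P2Sigma u = 0 := by
  obtain ⟨c, rfl⟩ := S.exists_coeff hu
  rw [P2Sigma_apply]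
  refine Finset.sum_eq_zero fun i _ => Finset.sum_eq_zero fun j hj => ?_
  have h := S.q_sum (fun i _ => c i) (fun _ => {1}) (fun i => by simpa using S.one_le_m i)
    (k := i) (l := j) (Finset.Icc_subset_Icc_left (by norm_num) hj)
  have hj1 : j ∉ ({1} : Finset ℕ) := by
    have := (Finset.mem_Icc.1 hj).1
    simp; omega
  rw [if_neg hj1] at h
  simp only [Finset.sum_singleton] at h
  rw [map_sum]
  simp_rw [map_smul]
  rw [h, zero_smul]

theorem P1_of_mem {u : D} (hu : u ∈ S.D20) : S.P1 u = 0 := by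
  have := S.P1_add_P2Sigma u
  rwa [S.P20_of_mem hu, S.P2Sigma_of_mem hu, add_zero, sub_self] at this

theorem b_P2 (x : D) : b (S.P2 x) = S.Q2 (b x) := by
  rw [P2_apply, Q2_apply]
  simp [map_sum]

theorem q_Q1 {k : Fin n} {l : ℕ} (hl : l ∈ Finset.Icc 1 (S.m k)) (y : Y) :
    S.q k l (S.Q1 y) = 0 := by
  rw [Q1, sub_apply, map_sub, Q2_apply,
    S.q_sum (fun i j => S.q i j y) (fun i => Finset.Icc 1 (S.m i)) (fun _ => subset_rfl) hl,
    if_pos hl]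
  simp

theorem b_P1 (x : D) : b (S.P1 x) = S.Q1 (b x) := by
  rw [P1, Q1, LinearMap.sub_apply, map_sub, b_P2]
  simp

theorem Q2Star_eq_zero_iff (y : Y) : S.Q2Star y = 0 ↔ ∀ k, S.q k (S.m k) y = 0 := by
  constructor
  · intro h k
    rw [← S.q_sum_last (fun i => S.q i (S.m i) y), ← Q2Star_apply, h, map_zero]
  · intro h
    rw [Q2Star_apply]
    simp [h]

theorem Q2Star_Q2Star (y : Y) : S.Q2Star (S.Q2Star y) = S.Q2Star y := by
  rw [← sub_eq_zero, ← map_sub, Q2Star_eq_zero_iff]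
  intro k
  rw [map_sub, Q2Star_apply, S.q_sum_last, sub_self]

theorem Q2Star_a (x : D) : S.Q2Star (a x) = 0 :=
  (S.Q2Star_eq_zero_iff _).2 fun k => S.dual_last k x

theorem Q2Star_b_P1 (x : D) : S.Q2Star (b (S.P1 x)) = 0 := by
  rw [b_P1, Q2Star_eq_zero_iff]
  exact fun k => S.q_Q1 (S.m_mem_Icc k) _

/-- `W = Y₁ ∔ Y_{2Σ}` is the kernel of the projector `Q_{2*}`. -/
theorem mem_W_iff (y : Y) : y ∈ S.W ↔ S.Q2Star y = 0 := by
  constructor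
  · have h1 : S.Y1 ≤ LinearMap.ker (S.Q2Star : Y →ₗ[𝕜] Y) := by
      rintro _ ⟨y, rfl⟩
      exact (S.Q2Star_eq_zero_iff _).2 fun k => S.q_Q1 (S.m_mem_Icc k) _
    have h2 : S.Y2Sigma ≤ LinearMap.ker (S.Q2Star : Y →ₗ[𝕜] Y) := by
      refine Submodule.span_le.2 ?_
      rintro _ ⟨i, j, hj, rfl⟩
      refine (S.Q2Star_eq_zero_iff _).2 fun k => ?_
      have hj' := Finset.mem_Ico.1 hj
      rw [S.biorthogonal i k j (Finset.mem_Icc.2 ⟨hj'.1, hj'.2.le⟩) _ (S.m_mem_Icc k), if_neg]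
      rintro ⟨rfl, h⟩
      omega
    exact fun h => sup_le h1 h2 h
  · intro h
    have h1 := S.Q1_add_Q2Sigma_apply y
    rw [h, sub_zero] at h1
    rw [← h1]
    refine Submodule.add_mem_sup ⟨y, rfl⟩ ?_
    change S.Q2Sigma y ∈ S.Y2Sigma
    rw [Q2Sigma_apply]
    exact Submodule.sum_mem _ fun i _ => Submodule.sum_mem _ fun j hj =>
      Submodule.smul_mem _ _ (Submodule.subset_span ⟨i, j, hj, rfl⟩)

theorem isClosed_W : IsClosed (S.W : Set Y) := by
  have : (S.W : Set Y) = {y | S.Q2Star y = 0} := by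
    ext y; exact S.mem_W_iff y
  rw [this]
  exact isClosed_eq S.Q2Star.continuous continuous_const

theorem a_mem_W (x : D) : a x ∈ S.W := (S.mem_W_iff _).2 (S.Q2Star_a x)

theorem sub_Q2Star_mem_W (y : Y) : y - S.Q2Star y ∈ S.W := by
  rw [mem_W_iff, map_sub, Q2Star_Q2Star, sub_self]

/-- `Ã` agrees with `A` on `D₁ ∔ D_{2Σ}`, and `A` does not see the component in `ker A`. -/
theorem Atilde_sub_P20 (x : D) : S.Atilde (x - S.P20 x) = a x := by
  rw [Atilde_apply, map_sub, a_P20, sub_zero, add_eq_left]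
  refine Finset.sum_eq_zero fun i _ => ?_
  rw [map_sub, P20_apply, map_sum]
  simp_rw [map_smul]
  rw [map_sub, S.q_sum_one, sub_self, zero_smul]

/-- The preimage of `W` under `Ã` is `D₁ ∔ D_{2Σ}`. -/
theorem P20_eq_zero_of_Atilde_mem {x : D} (h : S.Atilde x ∈ S.W) : S.P20 x = 0 := by
  rw [mem_W_iff, Q2Star_eq_zero_iff] at h
  rw [P20_apply]
  refine Finset.sum_eq_zero fun i _ => ?_
  have := h i
  rw [Atilde_apply, map_add, S.dual_last, zero_add, S.q_sum_last] at this
  rw [this, zero_smul]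

theorem Atilde_injective : Function.Injective S.Atilde := by
  refine (injective_iff_map_eq_zero _).2 fun x hx => ?_
  have h1 : S.P20 x = 0 := S.P20_eq_zero_of_Atilde_mem (by rw [hx]; exact zero_mem _)
  have h2 := S.Atilde_sub_P20 x
  rw [h1, sub_zero, hx] at h2
  rw [← h1, S.P20_of_mem h2.symm]

/-- The projectors intertwine: `A P₂ = Q₂ A`, by the chain relations for `φ i j` and `q i j`. -/
theorem a_P2 (x : D) : a (S.P2 x) = S.Q2 (a x) := by
  rw [Q2_eq, add_apply, Q2Star_a, zero_add, Q2Sigma_apply, P2_eq, LinearMap.add_apply, map_add,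
    a_P20, zero_add, P2Sigma_apply, map_sum]
  refine Finset.sum_congr rfl fun i _ => ?_
  rw [map_sum]
  have h1 : ∀ j ∈ Finset.Icc 2 (S.m i), a (S.q i j (b x) • S.φ i j) =
      -(S.q i j (b x) • b (S.φ i (j - 1))) := fun j hj => by
    rw [map_smul, S.chain i j hj, smul_neg]
  have h2 : ∀ j ∈ Finset.Ico 1 (S.m i), S.q i j (a x) • b (S.φ i j) =
      -(S.q i (j + 1) (b x) • b (S.φ i j)) := fun j hj => by
    rw [S.dual_chain i j hj, neg_smul]
  rw [Finset.sum_congr rfl h1, Finset.sum_congr rfl h2]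
  refine Finset.sum_nbij' (fun j => j - 1) (fun j => j + 1) ?_ ?_ ?_ ?_ ?_
  · intro j hj; simp only [Finset.mem_Icc, Finset.mem_Ico] at *; omega
  · intro j hj; simp only [Finset.mem_Icc, Finset.mem_Ico] at *; omega
  · intro j hj; simp only [Finset.mem_Icc] at *; omega
  · intro j hj; simp only [Finset.mem_Ico] at *; omega
  · intro j hj
    have : j - 1 + 1 = j := by simp only [Finset.mem_Icc] at hj; omega
    rw [this]

theorem a_P1 (x : D) : a (S.P1 x) = S.Q1 (a x) := by
  rw [P1, Q1, LinearMap.sub_apply, map_sub, a_P2]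
  simp

theorem P20_P1 (x : D) : S.P20 (S.P1 x) = 0 := by
  rw [P20_apply]
  refine Finset.sum_eq_zero fun i _ => ?_
  rw [b_P1, S.q_Q1 (S.one_mem_Icc i), zero_smul]

end Algebra
end CanonicalSystem

/-! ### Bounded invertibility of `Ã` -/

section Inverse

variable {𝕜 X Y : Type*} [RCLike 𝕜] [NormedAddCommGroup X] [NormedSpace 𝕜 X]
  [NormedAddCommGroup Y] [NormedSpace 𝕜 Y]

/-- For small real `r ≠ 0` the complexified pencil splits, so `A + r B` itself is a bijection. -/
theorem bijective_add_smul_of_resolventBound {D : Submodule 𝕜 X} {a b : D →ₗ[𝕜] Y} {k : ℕ}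
    (h : ResolventBound a b k) :
    ∃ ρ : ℝ, 0 < ρ ∧ ∀ r : ℝ, 0 < r → r ≤ ρ → Function.Bijective (a + (r : 𝕜) • b) := by
  obtain ⟨C, ρ, hρ, h⟩ := h
  refine ⟨ρ, hρ, fun r hr hrρ => ?_⟩
  obtain ⟨S, hS1, hS2, -⟩ := h (r : ℂ) (by exact_mod_cast hr.ne')
    (by rwa [Complex.norm_real, Real.norm_of_nonneg hr.le])
  have hc : ∀ d : D × D, complexPencil a b (r : ℂ) d =
      ((a + (r : 𝕜) • b) d.1, (a + (r : 𝕜) • b) d.2) := fun d => by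
    simp [complexPencil]
  constructor
  · refine (injective_iff_map_eq_zero _).2 fun d hd => ?_
    have := hS2 (d, 0)
    rw [hc] at this
    simp only [hd, map_zero] at this
    have h0 : S ((0 : Y), (0 : Y)) = 0 := S.map_zero
    rw [h0] at this
    exact Subtype.ext (Prod.ext_iff.1 this).1.symm
  · intro y
    obtain ⟨d, -, hd⟩ := hS1 (y, 0)
    rw [hc] at hd
    exact ⟨d.1, (Prod.ext_iff.1 hd).1⟩

/-- An injective finite-rank perturbation of a linear bijection is surjective. -/
theorem surjective_of_sub_mem_finiteDimensional {M N : Type*} [AddCommGroup M] [Module 𝕜 M]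
    [AddCommGroup N] [Module 𝕜 N] {T T' : M →ₗ[𝕜] N} (hT : Function.Bijective T)
    (hT' : Function.Injective T') (Z : Submodule 𝕜 N) [FiniteDimensional 𝕜 Z]
    (hZ : ∀ x, T' x - T x ∈ Z) : Function.Surjective T' := by
  set e := LinearEquiv.ofBijective T hT
  have he : ∀ y, T (e.symm y) = y := fun y => e.apply_symm_apply y
  -- `T' T⁻¹` maps `Z` to itself, since it differs from the identity by vectors in `Z`
  have hmaps : ∀ z ∈ Z, (T' ∘ₗ e.symm.toLinearMap) z ∈ Z := fun z hz => by
    have := Z.add_mem (hZ (e.symm z)) hz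
    rwa [he, sub_add_cancel] at this
  have hinj : Function.Injective ((T' ∘ₗ e.symm.toLinearMap).restrict hmaps) := by
    intro z z' h
    have h1 : T' (e.symm z) = T' (e.symm z') := congrArg Subtype.val h
    exact Subtype.ext (e.symm.injective (hT' h1))
  have hsurj := LinearMap.injective_iff_surjective.1 hinj
  intro y
  have hy := hZ (e.symm y)
  rw [he] at hy
  obtain ⟨z, hz⟩ := hsurj ⟨_, hy⟩
  have hz' : T' (e.symm z) = T' (e.symm y) - y := congrArg Subtype.val hz
  exact ⟨e.symm y - e.symm z, by rw [map_sub, hz', sub_sub_cancel]⟩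

/-- If `T + r L` is surjective for arbitrarily small `r > 0` and `T` is bounded below with closed
range, then `T` is surjective: the solutions of `(T + r L) x = y` stay bounded as `r → 0`. -/
theorem surjective_of_perturbation {E : Type*} [NormedAddCommGroup E] [NormedSpace 𝕜 E]
    {T L : E →L[𝕜] Y} {K : NNReal} (hT : AntilipschitzWith K T) (hcl : IsClosed (range T)) {ρ : ℝ}
    (hρ : 0 < ρ)
    (h : ∀ r : ℝ, 0 < r → r ≤ ρ → Function.Injective (T + (r : 𝕜) • L) →
      Function.Surjective (T + (r : 𝕜) • L)) : Function.Surjective T := by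
  intro y
  have hbound : ∀ x, ‖x‖ ≤ K * ‖T x‖ := fun x => T.bound_of_antilipschitz hT x
  have hr0 : ∀ᶠ r : ℝ in 𝓝[>] 0, K * (r * ‖L‖) ≤ 1 / 2 := by
    have : Tendsto (fun r : ℝ => K * (r * ‖L‖)) (𝓝[>] 0) (𝓝 0) := by
      have h1 : Continuous fun r : ℝ => K * (r * ‖L‖) := by fun_prop
      simpa using (h1.tendsto 0).mono_left nhdsWithin_le_nhds
    exact (this.eventually (gt_mem_nhds (by norm_num : (0 : ℝ) < 1 / 2))).mono fun _ h => h.le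
  have hpert : ∀ r : ℝ, 0 < r → K * (r * ‖L‖) ≤ 1 / 2 → ∀ x,
      ‖x‖ ≤ 2 * K * ‖(T + (r : 𝕜) • L) x‖ := by
    intro r hr hKr x
    have h1 : T x = (T + (r : 𝕜) • L) x - (r : 𝕜) • L x := by simp
    have h2 : ‖T x‖ ≤ ‖(T + (r : 𝕜) • L) x‖ + r * (‖L‖ * ‖x‖) := by
      rw [h1]
      refine (norm_sub_le _ _).trans (add_le_add_right ?_ _)
      rw [norm_smul, RCLike.norm_ofReal, abs_of_pos hr]
      gcongr
      exact L.le_opNorm x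
    have h3 := (hbound x).trans (mul_le_mul_of_nonneg_left h2 K.2)
    have h4 := mul_le_mul_of_nonneg_right hKr (norm_nonneg x)
    change ‖x‖ ≤ K * (‖(T + (r : 𝕜) • L) x‖ + r * (‖L‖ * ‖x‖)) at h3
    nlinarith
  have hsol : ∀ᶠ r : ℝ in 𝓝[>] 0, ∃ x, ‖x‖ ≤ 2 * K * ‖y‖ ∧ y - T x = (r : 𝕜) • L x := by
    filter_upwards [hr0, Ioc_mem_nhdsGT hρ] with r hKr hr
    have hinj : Function.Injective (T + (r : 𝕜) • L) := by
      refine (injective_iff_map_eq_zero _).2 fun x hx => ?_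
      have := hpert r hr.1 hKr x
      rw [hx, norm_zero, mul_zero] at this
      exact norm_le_zero_iff.1 this
    obtain ⟨x, hx⟩ := h r hr.1 hr.2 hinj y
    refine ⟨x, ?_, ?_⟩
    · rw [← hx]; exact hpert r hr.1 hKr x
    · rw [← hx]; simp
  have hmem : y ∈ closure (range T) := by
    refine Metric.mem_closure_iff.2 fun ε hε => ?_
    have h0 : Tendsto (fun r : ℝ => r * (‖L‖ * (2 * K * ‖y‖))) (𝓝[>] 0) (𝓝 0) := by
      have h1 : Continuous fun r : ℝ => r * (‖L‖ * (2 * K * ‖y‖)) := by fun_prop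
      simpa using (h1.tendsto 0).mono_left nhdsWithin_le_nhds
    obtain ⟨r, ⟨⟨x, hx, hxy⟩, hr⟩, hr0⟩ :=
      ((hsol.and (h0.eventually (gt_mem_nhds hε))).and self_mem_nhdsWithin).exists
    refine ⟨_, ⟨x, rfl⟩, ?_⟩
    have hr0' : 0 < r := hr0
    rw [dist_eq_norm, hxy, norm_smul, RCLike.norm_ofReal, abs_of_pos hr0']
    refine lt_of_le_of_lt ?_ hr
    gcongr
    exact (L.le_opNorm x).trans (by gcongr)
  rwa [hcl.closure_eq] at hmem

/-- `Ã` is a bijection of `D` onto `Y`, and both `Ã⁻¹` and `B Ã⁻¹` are bounded. The domain is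
completed by the graph norm of `A`, in which `A` and, by the closed graph theorem, `B` are bounded;
`Ã + r B` is a finite-rank perturbation of the bijection `A + r B`. -/
theorem exists_inverse_Atilde [CompleteSpace X] [CompleteSpace Y] (A B : X →ₗ.[𝕜] Y) (hA : A.IsClosed) (hB : B.IsClosed)
    (hAB : A.domain ≤ B.domain) {a b : A.domain →ₗ[𝕜] Y} (ha : a = A.toFun)
    (hb : b = B.toFun ∘ₗ Submodule.inclusion hAB) (hrange : IsClosed (Set.range a)) {n ν k : ℕ}
    (hres : ResolventBound a b k) (S : CanonicalSystem a b n ν) :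
    (∀ y, S.Atilde (S.AtildeInv y) = y) ∧
    (∃ T : Y →L[𝕜] A.domain, ∀ y, T y = S.AtildeInv y) ∧
    ∃ L : Y →L[𝕜] Y, ∀ y, L y = b (S.AtildeInv y) := by
  have hcl : IsClosed (A.graph : Set (X × Y)) := hA
  have : CompleteSpace A.graph := hcl.completeSpace_coe
  have hmemA : ∀ p : X × Y, p ∈ A.graph ↔ ∃ d : A.domain, (d : X) = p.1 ∧ a d = p.2 := fun p => by
    rw [LinearPMap.mem_graph_iff, ha]; rfl
  -- the graph of `A` as a Banach space in place of `D`
  set E := A.graph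
  let π : E →ₗ[𝕜] A.domain :=
    { toFun := fun p => ⟨p.1.1, by
        obtain ⟨d, hd, -⟩ := (hmemA p.1).1 p.2
        rw [← hd]; exact d.2⟩
      map_add' := fun _ _ => rfl
      map_smul' := fun _ _ => rfl }
  have hπc : Continuous π :=
    (continuous_fst.comp continuous_subtype_val).subtype_mk _
  have hπa : ∀ p : E, a (π p) = p.1.2 := fun p => by
    obtain ⟨d, hd, hd2⟩ := (hmemA p.1).1 p.2
    have : π p = d := Subtype.ext hd.symm
    rw [this, hd2]
  have hπinj : Function.Injective π := fun p p' h => by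
    refine Subtype.ext (Prod.ext (congrArg Subtype.val h) ?_)
    rw [← hπa, ← hπa, h]
  have hπsurj : Function.Surjective π := fun d =>
    ⟨⟨((d : X), a d), (hmemA _).2 ⟨d, rfl, rfl⟩⟩, rfl⟩
  have hac : Continuous (a ∘ₗ π) := by
    have : (fun p : E => a (π p)) = fun p : E => p.1.2 := funext hπa
    change Continuous fun p : E => a (π p)
    rw [this]
    exact continuous_snd.comp continuous_subtype_val
  have hbc : Continuous (b ∘ₗ π) := by
    refine LinearMap.continuous_of_seq_closed_graph _ fun u x y hu hbu => ?_
    have hB' : IsClosed (B.graph : Set (X × Y)) := hB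
    have h1 : Tendsto (fun n => ((u n).1.1, b (π (u n)))) atTop (𝓝 (x.1.1, y)) :=
      ((continuous_fst.comp continuous_subtype_val).tendsto x |>.comp hu).prodMk_nhds hbu
    have h2 : ((x.1.1, y) : X × Y) ∈ B.graph := hB'.mem_of_tendsto h1 (Eventually.of_forall fun n => by
      change _ ∈ B.graph
      rw [LinearPMap.mem_graph_iff, hb]
      exact ⟨Submodule.inclusion hAB (π (u n)), rfl, rfl⟩)
    rw [LinearPMap.mem_graph_iff] at h2
    obtain ⟨d, hd, hd2⟩ := h2
    rw [← show B d = y from hd2]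
    rw [hb]
    change B d = B.toFun (Submodule.inclusion hAB (π x))
    congr 1
    exact Subtype.ext hd
  have htc : Continuous (S.Atilde ∘ₗ π) := by
    have : ⇑(S.Atilde ∘ₗ π) = fun p => (a ∘ₗ π) p +
        ∑ i, S.q i 1 ((b ∘ₗ π) p) • b (S.φ i (S.m i)) := by
      ext p; exact S.Atilde_apply _
    rw [this]
    refine hac.add (continuous_finsetSum _ fun i _ => ?_)
    exact ((S.q i 1).continuous.comp hbc).smul continuous_const
  let aE : E →L[𝕜] Y := ⟨S.Atilde ∘ₗ π, htc⟩
  let bE : E →L[𝕜] Y := ⟨b ∘ₗ π, hbc⟩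
  have hinj : Function.Injective aE := S.Atilde_injective.comp hπinj
  have : FiniteDimensional 𝕜 S.Y2Star := FiniteDimensional.span_of_finite 𝕜 (Set.finite_range _)
  have hY2 : ∀ x, S.Atilde x - a x ∈ S.Y2Star := fun x => by
    rw [S.Atilde_apply, add_sub_cancel_left]
    exact Submodule.sum_mem _ fun i _ => Submodule.smul_mem _ _ (Submodule.subset_span ⟨i, rfl⟩)
  have hrangeEq : range aE = ((LinearMap.range a ⊔ S.Y2Star : Submodule 𝕜 Y) : Set Y) := by
    ext y
    constructor
    · rintro ⟨p, rfl⟩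
      have : aE p = a (π p) + (S.Atilde (π p) - a (π p)) := (add_sub_cancel _ _).symm
      rw [this]
      exact Submodule.add_mem_sup ⟨_, rfl⟩ (hY2 _)
    · intro hy
      obtain ⟨_, ⟨x, rfl⟩, z, hz, rfl⟩ := Submodule.mem_sup.1 hy
      obtain ⟨c, rfl⟩ := (Submodule.mem_span_range_iff_exists_fun 𝕜).1 hz
      obtain ⟨p, hp⟩ := hπsurj (x - S.P20 x + ∑ i, c i • S.φ i 1)
      refine ⟨p, ?_⟩
      change S.Atilde (π p) = _
      rw [hp, map_add, S.Atilde_sub_P20]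
      congr 1
      rw [S.Atilde_apply, map_sum, map_sum]
      simp_rw [map_smul, S.a_φ_one, S.q_sum_one]
      simp
  have hrcl : IsClosed (range aE) := by
    rw [hrangeEq]
    exact Submodule.isClosed_sup_finiteDimensional _ _ hrange
  obtain ⟨K, hK⟩ := aE.antilipschitz_of_injective_of_isClosed_range hinj hrcl
  obtain ⟨ρ, hρ, hbij⟩ := bijective_add_smul_of_resolventBound hres
  have hsurj : Function.Surjective aE := by
    refine surjective_of_perturbation (L := bE) hK hrcl hρ fun r hr hrρ hi => ?_
    have hT := (hbij r hr hrρ).comp ⟨hπinj, hπsurj⟩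
    refine surjective_of_sub_mem_finiteDimensional (T := (a + (r : 𝕜) • b) ∘ₗ π)
      (T' := ((aE + (r : 𝕜) • bE : E →L[𝕜] Y) : E →ₗ[𝕜] Y)) hT hi S.Y2Star fun p => ?_
    have : ((aE + (r : 𝕜) • bE : E →L[𝕜] Y) : E →ₗ[𝕜] Y) p - ((a + (r : 𝕜) • b) ∘ₗ π) p =
        S.Atilde (π p) - a (π p) := by
      change S.Atilde (π p) + (r : 𝕜) • b (π p) - (a (π p) + (r : 𝕜) • b (π p)) = _
      abel
    rw [this]
    exact hY2 _
  let e : E ≃L[𝕜] Y := ContinuousLinearEquiv.ofBijective aE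
    (LinearMap.ker_eq_bot.2 hinj) (LinearMap.range_eq_top.2 hsurj)
  have he : ∀ y, S.Atilde (π (e.symm y)) = y := fun y => e.apply_symm_apply y
  have hinv : ∀ y, S.AtildeInv y = π (e.symm y) := fun y => by
    refine S.Atilde_injective ?_
    rw [he]
    exact Function.invFun_eq ⟨_, he y⟩
  refine ⟨fun y => by rw [hinv, he], ⟨(⟨π, hπc⟩ : E →L[𝕜] A.domain).comp e.symm.toContinuousLinearMap,
    fun y => (hinv y).symm⟩, ⟨bE.comp e.symm.toContinuousLinearMap, fun y => ?_⟩⟩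
  rw [hinv]; rfl

end Inverse

/-! ### Solving the algebraic part for the component in the kernel -/

section Implicit

variable {𝕜 : Type*} [RCLike 𝕜] {P U N : Type*} [TopologicalSpace P]
  [NormedAddCommGroup U] [NormedSpace 𝕜 U] [NormedAddCommGroup N] [NormedSpace 𝕜 N]

/-- If `u ↦ u - L F(p, u)` is a contraction near `η(p')` for `p` near `p'`, then the globally unique
zero `η(p)` of `F(p, ·)` is the fixed point, and hence close to `η(p')`. -/
theorem continuousAt_of_contraction [CompleteSpace U] {F : P → U → N} {η : P → U}
    (hη : ∀ p, F p (η p) = 0) (huniq : ∀ p u, F p u = 0 → u = η p) {p' : P} {L : N →L[𝕜] U}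
    (hL : Function.Injective L) {θ δ : ℝ} (hθ0 : 0 ≤ θ) (hθ : θ < 1) (hδ : 0 < δ)
    (hF : ∀ᶠ p in 𝓝 p', ∀ u v, ‖u - η p'‖ < δ → ‖v - η p'‖ < δ →
      ‖(u - v) - L (F p u - F p v)‖ ≤ θ * ‖u - v‖)
    (hc : ContinuousAt (fun p => F p (η p')) p') : ContinuousAt η p' := by
  rw [Metric.continuousAt_iff']
  intro ε hε
  set r := min (ε / 2) (δ / 2) with hr
  have hr0 : 0 < r := by positivity
  have hrε : r < ε := (min_le_left _ _).trans_lt (by linarith)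
  have hrδ : r < δ := (min_le_right _ _).trans_lt (by linarith)
  have h1 : ∀ᶠ p in 𝓝 p', ‖L (F p (η p'))‖ < (1 - θ) * r := by
    have : ContinuousAt (fun p => ‖L (F p (η p'))‖) p' :=
      (L.continuous.continuousAt.comp hc).norm
    refine this.eventually_lt continuousAt_const ?_
    rw [hη, map_zero, norm_zero]
    exact mul_pos (by linarith) hr0
  filter_upwards [h1, hF] with p hp hpF
  set Ψ : U → U := fun u => u - L (F p u) with hΨ
  have hlip : ∀ u v, ‖u - η p'‖ < δ → ‖v - η p'‖ < δ → ‖Ψ u - Ψ v‖ ≤ θ * ‖u - v‖ := by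
    intro u v hu hv
    have : Ψ u - Ψ v = (u - v) - L (F p u - F p v) := by simp only [hΨ, map_sub]; abel
    rw [this]
    exact hpF u v hu hv
  have hball : ∀ u ∈ Metric.closedBall (η p') r, ‖u - η p'‖ < δ := fun u hu =>
    (mem_closedBall_iff_norm.1 hu).trans_lt hrδ
  have hself : ‖η p' - η p'‖ < δ := by simpa using hδ
  have hmaps : MapsTo Ψ (Metric.closedBall (η p') r) (Metric.closedBall (η p') r) := by
    intro u hu
    rw [mem_closedBall_iff_norm]
    have e : Ψ u - η p' = (Ψ u - Ψ (η p')) - L (F p (η p')) := by simp only [hΨ]; abel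
    rw [e]
    have h2 := hlip u (η p') (hball u hu) hself
    have h3 : θ * ‖u - η p'‖ ≤ θ * r :=
      mul_le_mul_of_nonneg_left (mem_closedBall_iff_norm.1 hu) hθ0
    have := norm_sub_le (Ψ u - Ψ (η p')) (L (F p (η p')))
    linarith
  have hcontr : ContractingWith ⟨θ, hθ0⟩ (hmaps.restrict Ψ _ _) := by
    refine ⟨hθ, LipschitzWith.of_dist_le_mul fun u v => ?_⟩
    change dist (Ψ u) (Ψ v) ≤ θ * dist (u : U) v
    rw [dist_eq_norm, dist_eq_norm]
    exact hlip u v (hball u u.2) (hball v v.2)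
  obtain ⟨y, hy, hfix, -⟩ := hcontr.exists_fixedPoint' Metric.isClosed_closedBall.isComplete hmaps
    (Metric.mem_closedBall_self hr0.le) (edist_ne_top _ _)
  have hy0 : L (F p y) = 0 := by
    have : y - L (F p y) = y := hfix
    simpa using this
  have : y = η p := huniq p y (hL (by rw [hy0, map_zero]))
  rw [← this]
  exact (Metric.mem_closedBall.1 hy).trans_lt hrε

/-- Zeros for different parameters differ by at most a multiple of the change of `F` at one of
them. -/
theorem norm_sub_le_of_contraction {P : Type*} {F : P → U → N} {L : N →L[𝕜] U} {θ : ℝ} (hθ : θ < 1)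
    {p q : P} {u v : U} (hu : F p u = 0) (hv : F q v = 0)
    (hF : ‖(u - v) - L (F p u - F p v)‖ ≤ θ * ‖u - v‖) :
    ‖u - v‖ ≤ (1 - θ)⁻¹ * (‖L‖ * ‖F p v - F q v‖) := by
  have h1 : u - v = ((u - v) - L (F p u - F p v)) - L (F p v - F q v) := by
    rw [hu, hv, zero_sub, map_neg, sub_zero]; abel
  have h2 : ‖u - v‖ ≤ θ * ‖u - v‖ + ‖L‖ * ‖F p v - F q v‖ := by
    conv_lhs => rw [h1]
    exact (norm_sub_le _ _).trans (add_le_add hF (L.le_opNorm _))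
  rw [inv_mul_eq_div, le_div_iff₀ (by linarith)]
  linarith

end Implicit

namespace CanonicalSystem

section Contraction

variable {𝕜 X Y : Type*} [RCLike 𝕜] [NormedAddCommGroup X] [NormedSpace 𝕜 X]
  [NormedAddCommGroup Y] [NormedSpace 𝕜 Y] {D : Submodule 𝕜 X}
  {a b : D →ₗ[𝕜] Y} {n ν : ℕ} (S : CanonicalSystem a b n ν)

theorem finiteDimensional_D20 : FiniteDimensional 𝕜 S.D20 := by
  have h : S.D20 = Submodule.span 𝕜 (Set.range fun i => S.φ i 1) := S.span_eq_ker.symm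
  rw [h]
  exact FiniteDimensional.span_of_finite 𝕜 (Set.finite_range _)

/-- Common consequence of the Lipschitz and of the smooth condition: near each point of `L₀` the map
`u ↦ u - W⁻¹ F_{2*}(t, x₁, x_{2Σ}, u)` is a contraction. -/
def ContractionCondition (f : ℝ → D → Y) (W : ℝ → D → (S.D20 ≃L[𝕜] S.Y2Star)) : Prop :=
  ∀ t' : ℝ, ∀ x' : D, (t', x') ∈ S.L0 f → ∃ δ > 0, ∃ θ : ℝ, 0 ≤ θ ∧ θ < 1 ∧
    ∀ t : ℝ, 0 ≤ t → |t - t'| < δ →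
    ∀ x1 ∈ S.D1, ‖x1 - S.P1 x'‖ < δ → ∀ x2 ∈ S.D2Sigma, ‖x2 - S.P2Sigma x'‖ < δ →
    ∀ u v : S.D20, ‖(u : D) - S.P20 x'‖ < δ → ‖(v : D) - S.P20 x'‖ < δ →
      ‖(u - v) - (W t' x').symm (S.F2Star f t x1 x2 u - S.F2Star f t x1 x2 v)‖ ≤ θ * ‖u - v‖

variable {S} {f : ℝ → D → Y} {W : ℝ → D → (S.D20 ≃L[𝕜] S.Y2Star)}

theorem norm_sub_symm_le (L : S.D20 ≃L[𝕜] S.Y2Star) (d : S.D20) (e : S.Y2Star) :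
    ‖d - L.symm e‖ ≤ ‖(L.symm : S.Y2Star →L[𝕜] S.D20)‖ * ‖e - L d‖ := by
  have : d - L.symm e = -(L.symm : S.Y2Star →L[𝕜] S.D20) (e - L d) := by
    simp
  rw [this, norm_neg]
  exact ContinuousLinearMap.le_opNorm _ _

theorem LipschitzCondition.contraction (h : S.LipschitzCondition f W) :
    S.ContractionCondition f W := by
  intro t' x' hL0
  obtain ⟨δ₀, hδ₀, ε₀, hε₀, q, l, hq, hl, hmain⟩ := h.2 t' x' hL0
  set M := ‖((W t' x').symm : S.Y2Star →L[𝕜] S.D20)‖ with hM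
  have h1 : ∀ᶠ p in 𝓝[>] (0 : ℝ) ×ˢ 𝓝[>] (0 : ℝ), q p * M < 1 :=
    (hq.mul_const M).eventually (gt_mem_nhds hl)
  have h2 : ∀ᶠ p in 𝓝[>] (0 : ℝ) ×ˢ 𝓝[>] (0 : ℝ), p.1 ∈ Ioc 0 δ₀ ∧ p.2 ∈ Ioc 0 ε₀ :=
    prod_mem_prod (Ioc_mem_nhdsGT hδ₀) (Ioc_mem_nhdsGT hε₀)
  obtain ⟨⟨δ, ε⟩, hqM, hδ, hε⟩ := (h1.and h2).exists
  refine ⟨min δ ε, lt_min hδ.1 hε.1, max 0 (q (δ, ε) * M), le_max_left _ _,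
    max_lt one_pos hqM, ?_⟩
  intro t ht0 ht x1 hx1 hx1' x2 hx2 hx2' u v hu hv
  have := hmain δ hδ ε hε t ht0 (ht.trans_le (min_le_left _ _)) x1 hx1
    (hx1'.trans_le (min_le_left _ _)) x2 hx2 (hx2'.trans_le (min_le_left _ _)) u v
    (hu.trans_le (min_le_right _ _)) (hv.trans_le (min_le_right _ _))
  calc _ ≤ M * (q (δ, ε) * ‖u - v‖) :=
        (norm_sub_symm_le _ _ _).trans (mul_le_mul_of_nonneg_left this (ContinuousLinearMap.opNorm_nonneg _))
    _ = q (δ, ε) * M * ‖u - v‖ := by ring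
    _ ≤ _ := mul_le_mul_of_nonneg_right (le_max_right _ _) (norm_nonneg _)

/-- Local mean value inequality for a function with a continuous partial derivative. -/
theorem exists_ball_norm_sub_le {f' : ℝ → D → (D →L[𝕜] Y)}
    (hf' : ∀ t : ℝ, 0 ≤ t → ∀ x : D, HasFDerivAt (𝕜 := 𝕜) (f t) (f' t x) x)
    (hc : ContinuousOn (fun p : ℝ × D => f' p.1 p.2) (Set.Ici 0 ×ˢ Set.univ))
    {t' : ℝ} (ht' : 0 ≤ t') (x' : D) {ε : ℝ} (hε : 0 < ε) :
    ∃ δ > 0, ∀ t : ℝ, 0 ≤ t → |t - t'| < δ → ∀ x ∈ Metric.ball x' δ, ∀ y ∈ Metric.ball x' δ,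
      ‖f t x - f t y - f' t' x' (x - y)‖ ≤ ε * ‖x - y‖ := by
  let _ : NormedSpace ℝ D := NormedSpace.restrictScalars ℝ 𝕜 D
  have h0 := hc (t', x') ⟨ht', mem_univ _⟩
  obtain ⟨δ, hδ, h⟩ := Metric.continuousWithinAt_iff.1 h0 ε hε
  refine ⟨δ, hδ, fun t ht htt x hx y hy => ?_⟩
  refine (convex_ball x' δ).norm_image_sub_le_of_norm_hasFDerivWithin_le' (𝕜 := 𝕜)
    (fun z _ => (hf' t ht z).hasFDerivWithinAt) (fun z hz => ?_) hy hx
  have := h (x := (t, z)) ⟨ht, mem_univ _⟩ (by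
    rw [Prod.dist_eq]
    exact max_lt (by rwa [Real.dist_eq]) hz)
  rw [dist_eq_norm] at this
  exact this.le

theorem SmoothCondition.locallyLipschitz (h : S.SmoothCondition f W) : LocallyLipschitzInX f := by
  obtain ⟨f', hf', hc, -⟩ := h
  intro t' ht' x'
  obtain ⟨δ, hδ, hmain⟩ := exists_ball_norm_sub_le hf' hc ht' x' one_pos
  refine ⟨δ, hδ, 1 + ‖f' t' x'‖, by positivity, fun t ht htt x hx y hy => ?_⟩
  have h1 := hmain t ht htt x hx y hy
  have h2 := (f' t' x').le_opNorm (x - y)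
  have h3 := norm_add_le (f t x - f t y - f' t' x' (x - y)) (f' t' x' (x - y))
  rw [sub_add_cancel] at h3
  linarith

/-- The derivative of `F_{2*}` in `u` at the point of `L₀` is `W`, so continuity of the derivative
gives a contraction constant `1 / 2` nearby. -/
theorem SmoothCondition.contraction (h : S.SmoothCondition f W) :
    S.ContractionCondition f W := by
  obtain ⟨f', hf', hc, hW⟩ := h
  intro t' x' hL0
  set M := ‖((W t' x').symm : S.Y2Star →L[𝕜] S.D20)‖ with hM
  have hM0 : 0 ≤ M := ContinuousLinearMap.opNorm_nonneg _
  set ε : ℝ := (2 * (M * ‖S.Q2Star‖ + 1))⁻¹ with hε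
  have hQ0 : 0 ≤ M * ‖S.Q2Star‖ := mul_nonneg hM0 (norm_nonneg _)
  obtain ⟨δ, hδ, hmain⟩ := exists_ball_norm_sub_le hf' hc hL0.1 x' (ε := ε) (by positivity)
  have hθ : M * ‖S.Q2Star‖ * ε ≤ 1 / 2 := by
    rw [hε, mul_inv, ← mul_assoc, mul_comm _ (2⁻¹ : ℝ), mul_assoc, ← div_eq_mul_inv]
    have : M * ‖S.Q2Star‖ / (M * ‖S.Q2Star‖ + 1) ≤ 1 := by
      rw [div_le_one (by positivity)]; linarith
    linarith
  refine ⟨δ / 3, by positivity, 1 / 2, by norm_num, by norm_num, ?_⟩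
  intro t ht0 ht x1 hx1 hx1' x2 hx2 hx2' u v hu hv
  have hball : ∀ u : S.D20, ‖(u : D) - S.P20 x'‖ < δ / 3 →
      x1 + x2 + (u : D) ∈ Metric.ball x' δ := by
    intro u hu
    have hx : x' = S.P1 x' + S.P2Sigma x' + S.P20 x' := by
      rw [S.P1_add_P2Sigma, sub_add_cancel]
    rw [mem_ball_iff_norm]
    have e : x1 + x2 + (u : D) - x' =
        (x1 - S.P1 x') + (x2 - S.P2Sigma x') + ((u : D) - S.P20 x') := by
      conv_lhs => rw [hx]
      abel
    rw [e]
    refine (norm_add₃_le).trans_lt ?_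
    linarith
  have hest : ‖S.F2Star f t x1 x2 u - S.F2Star f t x1 x2 v - W t' x' (u - v)‖ ≤
      ‖S.Q2Star‖ * (ε * ‖u - v‖) := by
    have e : ((S.F2Star f t x1 x2 u - S.F2Star f t x1 x2 v - W t' x' (u - v) : S.Y2Star) : Y) =
        S.Q2Star (f t (x1 + x2 + u) - f t (x1 + x2 + v) -
          f' t' x' ((x1 + x2 + u) - (x1 + x2 + v))) := by
      rw [add_sub_add_left_eq_sub]
      simp only [F2Star, AddSubgroupClass.coe_sub, hW t' x' hL0, map_sub, map_add]
      abel
    have hn : ∀ z : S.Y2Star, ‖z‖ = ‖(z : Y)‖ := fun _ => rfl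
    rw [hn, e]
    refine (S.Q2Star.le_opNorm _).trans (mul_le_mul_of_nonneg_left ?_ (norm_nonneg _))
    have := hmain t ht0 (ht.trans (by linarith)) _ (hball u hu) _ (hball v hv)
    rwa [show ‖(x1 + x2 + (u : D)) - (x1 + x2 + (v : D))‖ = ‖u - v‖ by
      rw [add_sub_add_left_eq_sub]; rfl] at this
  calc _ ≤ M * (‖S.Q2Star‖ * (ε * ‖u - v‖)) :=
        (norm_sub_symm_le _ _ _).trans (mul_le_mul_of_nonneg_left hest hM0)
    _ = M * ‖S.Q2Star‖ * ε * ‖u - v‖ := by ring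
    _ ≤ _ := mul_le_mul_of_nonneg_right hθ (norm_nonneg _)

end Contraction
end CanonicalSystem

/-! ### The reduced differential equation on `W` -/

section Reduced

variable {𝕜 X Y : Type*} [RCLike 𝕜] [NormedAddCommGroup X] [NormedSpace 𝕜 X]
  [NormedAddCommGroup Y] [NormedSpace 𝕜 Y] {D : Submodule 𝕜 X}
  {a b : D →ₗ[𝕜] Y} {n ν : ℕ} {S : CanonicalSystem a b n ν} {f : ℝ → D → Y}

/-- The data of the reduction to a differential equation for `w = A x ∈ W`: the bounded operators
`T = Ã⁻¹` and `K = B Ã⁻¹`, and the function `η(t, w)` giving the component `x₂₀ ∈ ker A` of the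
point of `L₀` over `t` and `T w ∈ D₁ ∔ D_{2Σ}`. Times are replaced by `max t 0`, so that everything is
defined on the whole line. -/
structure Reduction (S : CanonicalSystem a b n ν) (f : ℝ → D → Y) where
  T : Y →L[𝕜] D
  K : Y →L[𝕜] Y
  η : ℝ × S.W → S.D20
  Atilde_T : ∀ y, S.Atilde (T y) = y
  K_apply : ∀ y, K y = b (T y)
  mem_L0 : ∀ p, (max p.1 0, T p.2 + (η p : D)) ∈ S.L0 f
  eq_η : ∀ p, ∀ u : S.D20, (max p.1 0, T p.2 + (u : D)) ∈ S.L0 f → u = η p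

namespace Reduction

variable (r : Reduction S f)

/-- The point `x = T w + η(t, w)` of the phase space that belongs to `(t, w)`. -/
def state (p : ℝ × S.W) : D := r.T p.2 + (r.η p : D)

theorem T_Atilde (x : D) : r.T (S.Atilde x) = x :=
  S.Atilde_injective (r.Atilde_T _)

theorem T_a (x : D) : r.T (a x) = x - S.P20 x := by
  rw [← S.Atilde_sub_P20, T_Atilde]

theorem T_eq_AtildeInv (y : Y) : r.T y = S.AtildeInv y :=
  S.Atilde_injective <| by
    rw [r.Atilde_T]
    exact (Function.invFun_eq ⟨_, r.Atilde_T y⟩).symm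

theorem P20_T (w : S.W) : S.P20 (r.T w) = 0 :=
  S.P20_eq_zero_of_Atilde_mem (by rw [r.Atilde_T]; exact w.2)

theorem P1_add_P2Sigma_T (w : S.W) : S.P1 (r.T w) + S.P2Sigma (r.T w) = r.T w := by
  rw [S.P1_add_P2Sigma, r.P20_T, sub_zero]

theorem a_T (w : S.W) : a (r.T w) = w := by
  rw [← S.Atilde_sub_P20, r.P20_T, sub_zero, r.Atilde_T]

theorem a_state (p : ℝ × S.W) : a (r.state p) = p.2 := by
  have : a (r.η p : D) = 0 := (r.η p).2
  rw [state, map_add, r.a_T, this, add_zero]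

theorem P1_state (p : ℝ × S.W) : S.P1 (r.state p) = S.P1 (r.T p.2) := by
  rw [state, map_add, S.P1_of_mem (r.η p).2, add_zero]

theorem P2Sigma_state (p : ℝ × S.W) : S.P2Sigma (r.state p) = S.P2Sigma (r.T p.2) := by
  rw [state, map_add, S.P2Sigma_of_mem (r.η p).2, add_zero]

theorem P20_state (p : ℝ × S.W) : S.P20 (r.state p) = r.η p := by
  rw [state, map_add, S.P20_of_mem (r.η p).2, r.P20_T, zero_add]

/-- A point of `L₀` is recovered from `A x`. -/
theorem state_a {t : ℝ} (ht : 0 ≤ t) {x : D} (hx : (t, x) ∈ S.L0 f) :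
    r.state (t, ⟨a x, S.a_mem_W x⟩) = x := by
  have h : (⟨S.P20 x, S.P20_mem x⟩ : S.D20) = r.η (t, ⟨a x, S.a_mem_W x⟩) := by
    refine r.eq_η _ _ ?_
    simp only [r.T_a, sub_add_cancel, max_eq_left ht]
    exact hx
  rw [state, ← h]
  simp only [r.T_a, sub_add_cancel]

theorem continuous_P2Sigma_T : Continuous fun w : S.W => S.P2Sigma (r.T w) := by
  simp_rw [S.P2Sigma_apply, ← r.K_apply]
  refine continuous_finsetSum _ fun i _ => continuous_finsetSum _ fun j _ => ?_
  exact ((S.q i j).continuous.comp (r.K.continuous.comp continuous_subtype_val)).smul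
    continuous_const

theorem continuous_P1_T : Continuous fun w : S.W => S.P1 (r.T w) := by
  have : (fun w : S.W => S.P1 (r.T w)) = fun w : S.W => r.T w - S.P2Sigma (r.T w) := by
    ext w
    rw [eq_sub_of_add_eq (r.P1_add_P2Sigma_T w)]
  rw [this]
  exact (r.T.continuous.comp continuous_subtype_val).sub r.continuous_P2Sigma_T

/-- `F_{2*}` as a function of `(t, w)` and of the component in `ker A`. -/
def F (p : ℝ × S.W) (u : S.D20) : S.Y2Star :=
  S.F2Star f (max p.1 0) (S.P1 (r.T p.2)) (S.P2Sigma (r.T p.2)) u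

theorem coe_F (p : ℝ × S.W) (u : S.D20) :
    (r.F p u : Y) = S.Q2Star (f (max p.1 0) (r.T p.2 + u)) - S.Q2Star (r.K p.2) -
      S.Q2Star (b u) := by
  have h1 : S.Q2Star (b (S.P2Sigma (r.T p.2))) = S.Q2Star (r.K p.2) := by
    rw [r.K_apply]
    conv_rhs => rw [← r.P1_add_P2Sigma_T, map_add, map_add, S.Q2Star_b_P1, zero_add]
  simp only [F, CanonicalSystem.F2Star, r.P1_add_P2Sigma_T, map_add, h1]
  abel

theorem F_eq_zero_iff (p : ℝ × S.W) (u : S.D20) :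
    r.F p u = 0 ↔ (max p.1 0, r.T p.2 + (u : D)) ∈ S.L0 f := by
  rw [← Subtype.coe_inj, r.coe_F]
  simp only [CanonicalSystem.L0, mem_ofPred_eq, le_max_right, true_and, map_sub, map_add,
    r.K_apply, ZeroMemClass.coe_zero]
  rw [sub_sub]

theorem F_η (p : ℝ × S.W) : r.F p (r.η p) = 0 := (r.F_eq_zero_iff _ _).2 (r.mem_L0 p)

theorem continuous_f_comp {P D Y : Type*} [TopologicalSpace P] [TopologicalSpace D]
    [TopologicalSpace Y] {f : ℝ → D → Y}
    (hf : ContinuousOn (fun p : ℝ × D => f p.1 p.2) (Set.Ici 0 ×ˢ Set.univ)) {t : P → ℝ} {x : P → D}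
    (ht : Continuous t) (hx : Continuous x) : Continuous fun p => f (max (t p) 0) (x p) :=
  hf.comp_continuous (f := fun p => (max (t p) 0, x p))
    ((ht.max continuous_const).prodMk hx) fun p => ⟨le_max_right (t p) 0, mem_univ _⟩

/-- The contraction estimate near the point of `L₀` over `(t', w')`. -/
theorem eventually_contraction {W : ℝ → D → (S.D20 ≃L[𝕜] S.Y2Star)}
    (hW : S.ContractionCondition f W) (p' : ℝ × S.W) :
    ∃ δ > 0, ∃ θ : ℝ, 0 ≤ θ ∧ θ < 1 ∧ ∀ᶠ p in 𝓝 p', ∀ u v : S.D20,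
      ‖u - r.η p'‖ < δ → ‖v - r.η p'‖ < δ →
      ‖(u - v) - ((W (max p'.1 0) (r.state p')).symm : S.Y2Star →L[𝕜] S.D20)
        (r.F p u - r.F p v)‖ ≤ θ * ‖u - v‖ := by
  obtain ⟨δ, hδ, θ, hθ0, hθ, h⟩ := hW (max p'.1 0) (r.state p') (r.mem_L0 p')
  refine ⟨δ, hδ, θ, hθ0, hθ, ?_⟩
  have c1 : Continuous fun p : ℝ × S.W => max p.1 0 := continuous_fst.max continuous_const
  have c2 : Continuous fun p : ℝ × S.W => S.P1 (r.T p.2) := r.continuous_P1_T.comp continuous_snd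
  have c3 : Continuous fun p : ℝ × S.W => S.P2Sigma (r.T p.2) :=
    r.continuous_P2Sigma_T.comp continuous_snd
  filter_upwards [c1.continuousAt.eventually (Metric.ball_mem_nhds _ hδ),
    c2.continuousAt.eventually (Metric.ball_mem_nhds _ hδ),
    c3.continuousAt.eventually (Metric.ball_mem_nhds _ hδ)] with p h1 h2 h3 u v hu hv
  refine h (max p.1 0) (le_max_right _ _) h1 _ (S.P1_mem _) ?_ _ (S.P2Sigma_mem _) ?_ u v ?_ ?_
  · rw [r.P1_state]; exact mem_ball_iff_norm.1 h2
  · rw [r.P2Sigma_state]; exact mem_ball_iff_norm.1 h3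
  · rw [r.P20_state]; exact hu
  · rw [r.P20_state]; exact hv

theorem continuous_b_D20 : Continuous fun u : S.D20 => b (u : D) := by
  have := S.finiteDimensional_D20
  exact (b ∘ₗ S.D20.subtype).continuous_of_finiteDimensional

theorem continuous_η (hf : ContinuousOn (fun p : ℝ × D => f p.1 p.2) (Set.Ici 0 ×ˢ Set.univ))
    {W : ℝ → D → (S.D20 ≃L[𝕜] S.Y2Star)} (hW : S.ContractionCondition f W) :
    Continuous r.η := by
  have := S.finiteDimensional_D20
  have : CompleteSpace S.D20 := FiniteDimensional.complete 𝕜 _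
  refine continuous_iff_continuousAt.2 fun p' => ?_
  obtain ⟨δ, hδ, θ, hθ0, hθ, h⟩ := r.eventually_contraction hW p'
  refine continuousAt_of_contraction r.F_η (fun p u hu => r.eq_η p u ((r.F_eq_zero_iff p u).1 hu))
    (ContinuousLinearEquiv.injective _) hθ0 hθ hδ h (Continuous.continuousAt ?_)
  refine continuous_induced_rng.2 ?_
  have e : (Subtype.val ∘ fun p => r.F p (r.η p')) = fun p : ℝ × S.W =>
      S.Q2Star (f (max p.1 0) (r.T p.2 + r.η p')) - S.Q2Star (r.K p.2) - S.Q2Star (b (r.η p')) := by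
    ext p; exact r.coe_F p _
  rw [e]
  have cw : Continuous fun p : ℝ × S.W => (p.2 : Y) := continuous_subtype_val.comp continuous_snd
  exact ((S.Q2Star.continuous.comp (continuous_f_comp hf continuous_fst
    ((r.T.continuous.comp cw).add continuous_const))).sub
    (S.Q2Star.continuous.comp (r.K.continuous.comp cw))).sub continuous_const

theorem continuous_state
    (hf : ContinuousOn (fun p : ℝ × D => f p.1 p.2) (Set.Ici 0 ×ˢ Set.univ))
    {W : ℝ → D → (S.D20 ≃L[𝕜] S.Y2Star)} (hW : S.ContractionCondition f W) :
    Continuous r.state :=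
  (r.T.continuous.comp (continuous_subtype_val.comp continuous_snd)).add
    (continuous_subtype_val.comp (r.continuous_η hf hW))

theorem norm_T_sub_le (w₁ w₂ : S.W) : ‖r.T w₁ - r.T w₂‖ ≤ ‖r.T‖ * ‖w₁ - w₂‖ := by
  rw [← map_sub]
  exact r.T.le_opNorm _

theorem norm_K_sub_le (w₁ w₂ : S.W) : ‖r.K w₁ - r.K w₂‖ ≤ ‖r.K‖ * ‖w₁ - w₂‖ := by
  rw [← map_sub]
  exact r.K.le_opNorm _

/-- `η(t, w)` is Lipschitz in `w` near each point. -/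
theorem exists_lipschitz_η
    (hf : ContinuousOn (fun p : ℝ × D => f p.1 p.2) (Set.Ici 0 ×ˢ Set.univ))
    (hfl : LocallyLipschitzInX f)
    {W : ℝ → D → (S.D20 ≃L[𝕜] S.Y2Star)} (hW : S.ContractionCondition f W) (p' : ℝ × S.W) :
    ∃ C : ℝ, 0 ≤ C ∧ ∀ᶠ z : (ℝ × S.W) × (ℝ × S.W) in 𝓝 (p', p'), z.1.1 = z.2.1 →
      ‖r.η z.1 - r.η z.2‖ ≤ C * ‖z.1.2 - z.2.2‖ := by
  obtain ⟨δ, hδ, θ, hθ0, hθ, h⟩ := r.eventually_contraction hW p'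
  obtain ⟨δ', hδ', L, hL, hfL⟩ := hfl (max p'.1 0) (le_max_right _ _) (r.state p')
  set I := ((W (max p'.1 0) (r.state p')).symm : S.Y2Star →L[𝕜] S.D20)
  have hη := r.continuous_η hf hW
  have c0 : Continuous fun z : (ℝ × S.W) × (ℝ × S.W) => max z.1.1 0 :=
    (continuous_fst.comp continuous_fst).max continuous_const
  have c1 : Continuous fun z : (ℝ × S.W) × (ℝ × S.W) => r.T z.1.2 + (r.η z.2 : D) :=
    (r.T.continuous.comp (continuous_subtype_val.comp (continuous_snd.comp continuous_fst))).add
      (continuous_subtype_val.comp (hη.comp continuous_snd))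
  have c2 : Continuous fun z : (ℝ × S.W) × (ℝ × S.W) => r.T z.2.2 + (r.η z.2 : D) :=
    (r.T.continuous.comp (continuous_subtype_val.comp (continuous_snd.comp continuous_snd))).add
      (continuous_subtype_val.comp (hη.comp continuous_snd))
  have hηδ : ∀ᶠ p in 𝓝 p', ‖r.η p - r.η p'‖ < δ := by
    filter_upwards [hη.continuousAt.eventually (Metric.ball_mem_nhds (r.η p') hδ)] with p hp
    exact mem_ball_iff_norm.1 hp
  have hθ1 : 0 ≤ (1 - θ)⁻¹ := inv_nonneg.2 (by linarith)
  have hI0 : 0 ≤ ‖I‖ := ContinuousLinearMap.opNorm_nonneg _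
  refine ⟨(1 - θ)⁻¹ * (‖I‖ * (‖S.Q2Star‖ * (L * ‖r.T‖ + ‖r.K‖))),
    by have := norm_nonneg r.K; have := norm_nonneg r.T; positivity, ?_⟩
  have cfst : Tendsto Prod.fst (𝓝 (p', p')) (𝓝 p') := continuous_fst.tendsto _
  have csnd : Tendsto Prod.snd (𝓝 (p', p')) (𝓝 p') := continuous_snd.tendsto _
  filter_upwards [cfst.eventually h, cfst.eventually hηδ, csnd.eventually hηδ,
    (c0.tendsto (p', p')).eventually (Metric.ball_mem_nhds _ hδ'),
    (c1.tendsto (p', p')).eventually (Metric.ball_mem_nhds _ hδ'),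
    (c2.tendsto (p', p')).eventually (Metric.ball_mem_nhds _ hδ')]
    with z hz h1 h2 h3 h4 h5 ht
  have key := norm_sub_le_of_contraction (F := r.F) hθ (r.F_η z.1) (r.F_η z.2)
    (hz (r.η z.1) (r.η z.2) h1 h2)
  refine key.trans ?_
  have hF : ‖r.F z.1 (r.η z.2) - r.F z.2 (r.η z.2)‖ ≤
      ‖S.Q2Star‖ * ((L * ‖r.T‖ + ‖r.K‖) * ‖z.1.2 - z.2.2‖) := by
    have hn : ∀ y : S.Y2Star, ‖y‖ = ‖(y : Y)‖ := fun _ => rfl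
    have e : ((r.F z.1 (r.η z.2) - r.F z.2 (r.η z.2) : S.Y2Star) : Y) =
        S.Q2Star ((f (max z.1.1 0) (r.T z.1.2 + r.η z.2) - f (max z.1.1 0) (r.T z.2.2 + r.η z.2)) -
          (r.K z.1.2 - r.K z.2.2)) := by
      rw [AddSubgroupClass.coe_sub, r.coe_F, r.coe_F, ← ht]
      simp only [map_sub]
      abel
    rw [hn, e]
    refine (S.Q2Star.le_opNorm _).trans (mul_le_mul_of_nonneg_left ?_ (norm_nonneg _))
    have hf1 := hfL (max z.1.1 0) (le_max_right _ _) h3 _ h4 _ h5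
    rw [add_sub_add_right_eq_sub] at hf1
    have hf2 := mul_le_mul_of_nonneg_left (r.norm_T_sub_le z.1.2 z.2.2) hL
    have hf3 := r.norm_K_sub_le z.1.2 z.2.2
    have hf4 := norm_sub_le
      (f (max z.1.1 0) (r.T z.1.2 + r.η z.2) - f (max z.1.1 0) (r.T z.2.2 + r.η z.2))
      (r.K z.1.2 - r.K z.2.2)
    linarith
  calc _ ≤ (1 - θ)⁻¹ * (‖I‖ * (‖S.Q2Star‖ * ((L * ‖r.T‖ + ‖r.K‖) * ‖z.1.2 - z.2.2‖))) := by
        gcongr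
    _ = _ := by ring

/-- The right-hand side `(Q₁ + Q_{2Σ}) [f(t, x) - B x]`, `x = T w + η(t, w)`, of the reduced
equation. -/
def G (t : ℝ) (w : S.W) : S.W :=
  ⟨f (max t 0) (r.state (t, w)) - r.K w - b (r.η (t, w)) -
    S.Q2Star (f (max t 0) (r.state (t, w)) - r.K w - b (r.η (t, w))), S.sub_Q2Star_mem_W _⟩

theorem b_state (p : ℝ × S.W) : b (r.state p) = r.K p.2 + b (r.η p) := by
  rw [state, map_add, r.K_apply]

theorem coe_G_eq (t : ℝ) (w : S.W) :
    (r.G t w : Y) = (S.Q1 + S.Q2Sigma) (f (max t 0) (r.state (t, w)) - b (r.state (t, w))) := by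
  rw [S.Q1_add_Q2Sigma_apply, r.b_state, ← sub_sub]
  rfl

/-- On `L₀` the projection in the definition of `G` is superfluous. -/
theorem coe_G (t : ℝ) (w : S.W) :
    (r.G t w : Y) = f (max t 0) (r.state (t, w)) - b (r.state (t, w)) := by
  have h : S.Q2Star (f (max t 0) (r.state (t, w)) - b (r.state (t, w))) = 0 := (r.mem_L0 (t, w)).2
  rw [coe_G_eq, S.Q1_add_Q2Sigma_apply, h, sub_zero]

theorem continuous_G
    (hf : ContinuousOn (fun p : ℝ × D => f p.1 p.2) (Set.Ici 0 ×ˢ Set.univ))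
    {W : ℝ → D → (S.D20 ≃L[𝕜] S.Y2Star)} (hW : S.ContractionCondition f W) :
    Continuous fun p : ℝ × S.W => r.G p.1 p.2 := by
  refine continuous_induced_rng.2 ?_
  have h : Continuous fun p : ℝ × S.W =>
      f (max p.1 0) (r.state p) - r.K p.2 - b (r.η p) :=
    ((continuous_f_comp hf continuous_fst (r.continuous_state hf hW)).sub
      (r.K.continuous.comp (continuous_subtype_val.comp continuous_snd))).sub
      (continuous_b_D20.comp (r.continuous_η hf hW))
  exact h.sub (S.Q2Star.continuous.comp h)

theorem exists_norm_b_le : ∃ c : ℝ, 0 ≤ c ∧ ∀ u : S.D20, ‖b (u : D)‖ ≤ c * ‖u‖ := by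
  have := S.finiteDimensional_D20
  set L := LinearMap.toContinuousLinearMap (b ∘ₗ S.D20.subtype) with hL
  exact ⟨‖L‖, L.opNorm_nonneg, fun u => L.le_opNorm u⟩

theorem locLipschitz_G
    (hf : ContinuousOn (fun p : ℝ × D => f p.1 p.2) (Set.Ici 0 ×ˢ Set.univ))
    (hfl : LocallyLipschitzInX f)
    {W : ℝ → D → (S.D20 ≃L[𝕜] S.Y2Star)} (hW : S.ContractionCondition f W) : LocLipschitz r.G := by
  intro t' w'
  obtain ⟨C, hC, hη⟩ := r.exists_lipschitz_η hf hfl hW (t', w')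
  obtain ⟨δ₁, hδ₁, L, hL, hfL⟩ := hfl (max t' 0) (le_max_right _ _) (r.state (t', w'))
  obtain ⟨c, hc, hb⟩ := exists_norm_b_le (S := S)
  have hst := r.continuous_state hf hW
  have h1 : ∀ᶠ p : ℝ × S.W in 𝓝 (t', w'), r.state p ∈ Metric.ball (r.state (t', w')) δ₁ ∧
      |max p.1 0 - max t' 0| < δ₁ :=
    (hst.continuousAt.eventually (Metric.ball_mem_nhds _ hδ₁)).and
      ((continuous_fst.max continuous_const).continuousAt.eventually (Metric.ball_mem_nhds _ hδ₁))
  obtain ⟨δ₂, hδ₂, h1⟩ := Metric.eventually_nhds_iff_ball.1 h1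
  obtain ⟨δ₃, hδ₃, hη⟩ := Metric.eventually_nhds_iff_ball.1 hη
  set M : ℝ := (1 + ‖S.Q2Star‖) * (L * (‖r.T‖ + C) + ‖r.K‖ + c * C) with hM
  have hM0 : 0 ≤ M := by have := norm_nonneg r.K; have := norm_nonneg r.T; positivity
  refine ⟨min δ₂ δ₃, lt_min hδ₂ hδ₃, ⟨M, hM0⟩, fun t ht => ?_⟩
  refine LipschitzOnWith.of_dist_le_mul fun w₁ hw₁ w₂ hw₂ => ?_
  have hp : ∀ w ∈ Metric.ball w' (min δ₂ δ₃), dist (t, w) (t', w') < min δ₂ δ₃ := fun w hw => by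
    rw [Prod.dist_eq]; exact max_lt (by rwa [Real.dist_eq]) hw
  have hη12 : ‖r.η (t, w₁) - r.η (t, w₂)‖ ≤ C * ‖w₁ - w₂‖ := by
    refine hη ((t, w₁), (t, w₂)) ?_ rfl
    rw [Metric.mem_ball, Prod.dist_eq]
    exact max_lt ((hp w₁ hw₁).trans_le (min_le_right _ _)) ((hp w₂ hw₂).trans_le (min_le_right _ _))
  have hst12 : ‖r.state (t, w₁) - r.state (t, w₂)‖ ≤ (‖r.T‖ + C) * ‖w₁ - w₂‖ := by
    have e : r.state (t, w₁) - r.state (t, w₂) =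
        (r.T w₁ - r.T w₂) + ((r.η (t, w₁) - r.η (t, w₂) : S.D20) : D) := by
      simp only [state, AddSubgroupClass.coe_sub]; abel
    rw [e, add_mul]
    exact (norm_add_le _ _).trans (add_le_add (r.norm_T_sub_le _ _) hη12)
  obtain ⟨hs1, hm⟩ := h1 (t, w₁) ((hp w₁ hw₁).trans_le (min_le_left _ _))
  obtain ⟨hs2, -⟩ := h1 (t, w₂) ((hp w₂ hw₂).trans_le (min_le_left _ _))
  have hf1 := (hfL (max t 0) (le_max_right _ _) hm _ hs1 _ hs2).trans
    (mul_le_mul_of_nonneg_left hst12 hL)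
  have hb1 := (hb (r.η (t, w₁) - r.η (t, w₂))).trans (mul_le_mul_of_nonneg_left hη12 hc)
  set y : S.W → Y := fun w => f (max t 0) (r.state (t, w)) - r.K w - b (r.η (t, w)) with hy
  have hy12 : ‖y w₁ - y w₂‖ ≤ (L * (‖r.T‖ + C) + ‖r.K‖ + c * C) * ‖w₁ - w₂‖ := by
    have e : y w₁ - y w₂ = (f (max t 0) (r.state (t, w₁)) - f (max t 0) (r.state (t, w₂))) +
        -(r.K w₁ - r.K w₂) + -(b ((r.η (t, w₁) - r.η (t, w₂) : S.D20) : D)) := by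
      simp only [hy, AddSubgroupClass.coe_sub, map_sub]; abel
    rw [e]
    refine (norm_add₃_le).trans ?_
    rw [norm_neg, norm_neg]
    have := r.norm_K_sub_le w₁ w₂
    linarith
  change dist (r.G t w₁) (r.G t w₂) ≤ M * dist w₁ w₂
  rw [dist_eq_norm, dist_eq_norm]
  have e : ((r.G t w₁ - r.G t w₂ : S.W) : Y) = (y w₁ - y w₂) - S.Q2Star (y w₁ - y w₂) := by
    rw [AddSubgroupClass.coe_sub, map_sub]
    change (y w₁ - S.Q2Star (y w₁)) - (y w₂ - S.Q2Star (y w₂)) = _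
    abel
  have hn : ∀ y : S.W, ‖y‖ = ‖(y : Y)‖ := fun _ => rfl
  rw [hn, e]
  have h5 := norm_sub_le (y w₁ - y w₂) (S.Q2Star (y w₁ - y w₂))
  have h6 := S.Q2Star.le_opNorm (y w₁ - y w₂)
  calc _ ≤ (1 + ‖S.Q2Star‖) * ‖y w₁ - y w₂‖ := by linarith
    _ ≤ (1 + ‖S.Q2Star‖) * ((L * (‖r.T‖ + C) + ‖r.K‖ + c * C) * ‖w₁ - w₂‖) := by gcongr
    _ = _ := by rw [hM]; ring

/-- On `L₀` the function `F_{2*}` vanishes, so the boundedness condition bounds `η`, and with it the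
right-hand side of the reduced equation, on bounded sets. -/
theorem exists_norm_G_le {W : ℝ → D → (S.D20 ≃L[𝕜] S.Y2Star)} (h : S.BoundednessCondition f W)
    (t₁ M : ℝ) : ∃ C, ∀ t, t ≤ t₁ → ∀ w : S.W, ‖w‖ ≤ M → ‖r.G t w‖ ≤ C := by
  obtain ⟨k, hk, h1, C, h2⟩ := h (max t₁ 1) (by positivity) (max (‖r.T‖ * M) 1) (by positivity)
  obtain ⟨c, hc, hb⟩ := exists_norm_b_le (S := S)
  refine ⟨C + ‖S.Q1 + S.Q2Sigma‖ * (‖r.K‖ * M + c * k), fun t ht w hw => ?_⟩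
  have hL0 := r.mem_L0 (t, w)
  have hlt : max t 0 ≤ max t₁ 1 := max_le_max ht zero_le_one
  have hTw : ‖S.P1 (r.state (t, w)) + S.P2Sigma (r.state (t, w))‖ ≤ max (‖r.T‖ * M) 1 := by
    rw [r.P1_state, r.P2Sigma_state, r.P1_add_P2Sigma_T]
    refine ((r.T.le_opNorm _).trans ?_).trans (le_max_left _ _)
    exact mul_le_mul_of_nonneg_left hw (norm_nonneg _)
  have hF : S.F2Star f (max t 0) (S.P1 (r.state (t, w))) (S.P2Sigma (r.state (t, w)))
      (S.P20 (r.state (t, w))) = 0 := by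
    rw [r.P1_state, r.P2Sigma_state, r.P20_state]
    exact r.F_η (t, w)
  have hη : ‖r.η (t, w)‖ ≤ k := by
    have e := h1 (max t 0) (r.state (t, w)) hL0 hlt hTw
    rw [hF, map_zero, ZeroMemClass.coe_zero, sub_zero, r.P20_state] at e
    exact e
  have hf := h2 (max t 0) (r.state (t, w)) hL0 hlt hTw (by rw [r.P20_state]; exact hη)
  have hn : ∀ y : S.W, ‖y‖ = ‖(y : Y)‖ := fun _ => rfl
  rw [hn, coe_G_eq, map_sub, r.b_state]
  refine (norm_sub_le _ _).trans (add_le_add hf ((ContinuousLinearMap.le_opNorm _ _).trans ?_))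
  refine mul_le_mul_of_nonneg_left ((norm_add_le _ _).trans (add_le_add ?_ ?_)) (norm_nonneg _)
  · exact (r.K.le_opNorm _).trans (mul_le_mul_of_nonneg_left hw (norm_nonneg _))
  · exact (hb _).trans (mul_le_mul_of_nonneg_left hη hc)

/-- The reduced right-hand side is `Ã Π`. -/
theorem coe_G_eq_Pi {t : ℝ} (ht : 0 ≤ t) (w : S.W) :
    (r.G t w : Y) = S.Atilde (S.Pi f t (S.AtildeInv w + r.η (t, w))) := by
  rw [CanonicalSystem.Pi, ← r.T_eq_AtildeInv, ← r.T_eq_AtildeInv, r.Atilde_T, coe_G_eq,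
    max_eq_left ht]
  rfl

/-- Global solvability of the reduced equation. -/
theorem exists_global_solution [NormedSpace ℝ Y] [IsScalarTower ℝ 𝕜 Y] [CompleteSpace Y]
    (hf : ContinuousOn (fun p : ℝ × D => f p.1 p.2) (Set.Ici 0 ×ˢ Set.univ))
    (hfl : LocallyLipschitzInX f) {W : ℝ → D → (S.D20 ≃L[𝕜] S.Y2Star)}
    (hW : S.ContractionCondition f W) (h3 : S.BoundednessCondition f W) (h4 : S.GrowthCondition f)
    {t₀ : ℝ} (ht₀ : 0 ≤ t₀) (w₀ : S.W) :
    ∃ w : ℝ → S.W, w t₀ = w₀ ∧ ∀ t, t₀ ≤ t → HasDerivAt w (r.G t (w t)) t := by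
  have : CompleteSpace S.W := S.isClosed_W.completeSpace_coe
  obtain ⟨R, hR, V, U, ψ, hV, hV0, hU, hU0, hψ0, hψ, hdiv, hVt, ⟨l, hl, hVl⟩, hgrow⟩ := h4
  have hG := r.continuous_G hf hW
  have hGl := r.locLipschitz_G hf hfl hW
  refine exists_global_of_forall_rightSol hG hGl fun t₁ ht₁ => ?_
  obtain ⟨M, hM⟩ := exists_norm_le_of_growth hG hV hV0 hVt hl hVl hU hU0 hψ0 hψ hdiv
    (fun t ht w hw => by
      have hn : ∀ y : S.W, ‖y‖ = ‖(y : Y)‖ := fun _ => rfl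
      rw [hn, r.coe_G_eq_Pi ht]
      refine hgrow t w _ (r.η (t, w)).2 hw ?_
      have := r.mem_L0 (t, w)
      rwa [max_eq_left (show (0 : ℝ) ≤ (t, w).1 from ht), r.T_eq_AtildeInv] at this) ht₀ ht₁ w₀
  obtain ⟨C, hC⟩ := r.exists_norm_G_le h3 t₁ M
  exact exists_rightSol_of_bounded hG hGl ht₁ fun s hs α hα0 hα t ht =>
    hC t (ht.2.trans hs.2) _ (hM s hs α hα0 hα t ht)

end Reduction

/-- The reduction exists: `T` and `K` come from the bounded invertibility of `Ã`, and `η` from the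
unique solvability of the algebraic part. -/
theorem exists_reduction [CompleteSpace X] [CompleteSpace Y] (A B : X →ₗ.[𝕜] Y) (hA : A.IsClosed)
    (hB : B.IsClosed) (hAB : A.domain ≤ B.domain) {a b : A.domain →ₗ[𝕜] Y} (ha : a = A.toFun)
    (hb : b = B.toFun ∘ₗ Submodule.inclusion hAB) (hrange : IsClosed (Set.range a)) {n ν k : ℕ}
    (hres : ResolventBound a b k) (S : CanonicalSystem a b n ν) {f : ℝ → A.domain → Y}
    (h : S.UniqueConsistency f) : Nonempty (Reduction S f) := by
  obtain ⟨hinv, ⟨T, hT⟩, ⟨K, hK⟩⟩ := exists_inverse_Atilde A B hA hB hAB ha hb hrange hres S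
  have hTinv : ∀ y, S.Atilde (T y) = y := fun y => by rw [hT, hinv]
  have hsum : ∀ w : S.W, S.P1 (T w) + S.P2Sigma (T w) = T w := fun w => by
    rw [S.P1_add_P2Sigma, S.P20_eq_zero_of_Atilde_mem (by rw [hTinv]; exact w.2), sub_zero]
  have hex : ∀ p : ℝ × S.W, ∃ u : S.D20, (max p.1 0, T p.2 + (u : A.domain)) ∈ S.L0 f ∧
      ∀ v : S.D20, (max p.1 0, T p.2 + (v : A.domain)) ∈ S.L0 f → v = u := by
    intro p
    obtain ⟨u, ⟨hu, hu0⟩, huniq⟩ := h (max p.1 0) (le_max_right _ _) _ (S.P1_mem (T p.2)) _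
      (S.P2Sigma_mem (T p.2))
    rw [hsum] at hu0
    refine ⟨⟨u, hu⟩, hu0, fun v hv => Subtype.ext (huniq v ⟨v.2, ?_⟩)⟩
    rw [hsum]
    exact hv
  choose η hη0 hη using hex
  exact ⟨⟨T, K, η, hTinv, fun y => by rw [hK, hT], hη0, hη⟩⟩

end Reduced

/-! ### Behaviour of solutions at the initial time -/

section Initial

/-- A function on `(a, b)` whose derivative grows at most linearly has a limit at `a`: Gronwall's
inequality backwards in time bounds it, so it is Lipschitz. -/
theorem exists_tendsto_of_norm_deriv_le {E : Type*} [NormedAddCommGroup E] [NormedSpace ℝ E]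
    [CompleteSpace E] {a b : ℝ} (hab : a < b) {z z' : ℝ → E} {k C : ℝ} (hk : 0 ≤ k) (hC : 0 ≤ C)
    (hz : ∀ t ∈ Ioo a b, HasDerivAt z (z' t) t)
    (hbound : ∀ t ∈ Ioo a b, ‖z' t‖ ≤ k * ‖z t‖ + C) :
    ∃ l, Tendsto z (𝓝[>] a) (𝓝 l) := by
  obtain ⟨c, hac, hcb⟩ := exists_between hab
  set M := gronwallBound ‖z c‖ k C (c - a)
  have hzM : ∀ s ∈ Ioo a c, ‖z s‖ ≤ M := by
    intro s hs
    have hmem : ∀ τ ∈ Icc 0 (c - s), c - τ ∈ Ioo a b := fun τ hτ =>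
      ⟨by linarith [hτ.2, hs.1], by linarith [hτ.1]⟩
    have hd : ∀ τ ∈ Icc 0 (c - s), HasDerivAt (fun τ => z (c - τ)) (-z' (c - τ)) τ := fun τ hτ => by
      simpa [Function.comp_def] using (hz _ (hmem τ hτ)).scomp τ ((hasDerivAt_id τ).const_sub c)
    have h1 := norm_le_gronwallBound_of_norm_deriv_right_le (f := fun τ => z (c - τ))
      (f' := fun τ => -z' (c - τ)) (δ := ‖z c‖) (K := k) (ε := C) (a := 0) (b := c - s)
      (fun τ hτ => (hd τ hτ).continuousAt.continuousWithinAt)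
      (fun τ hτ => (hd τ ⟨hτ.1, hτ.2.le⟩).hasDerivWithinAt) (by simp)
      (fun τ hτ => by rw [norm_neg]; exact hbound _ (hmem τ ⟨hτ.1, hτ.2.le⟩))
      (c - s) ⟨by linarith [hs.2], le_rfl⟩
    simp only [sub_sub_cancel, sub_zero] at h1
    exact h1.trans (gronwallBound_mono (norm_nonneg _) hC hk (by linarith [hs.1]))
  have hlip : LipschitzOnWith (k * M + C).toNNReal z (Ioo a c) := by
    refine (convex_Ioo a c).lipschitzOnWith_of_nnnorm_hasDerivWithin_le (f' := z')
      (fun s hs => (hz s ⟨hs.1, hs.2.trans hcb⟩).hasDerivWithinAt) fun s hs => ?_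
    rw [← norm_toNNReal]
    refine Real.toNNReal_le_toNNReal ((hbound s ⟨hs.1, hs.2.trans hcb⟩).trans ?_)
    have := mul_le_mul_of_nonneg_left (hzM s hs) hk
    linarith
  have hne : (𝓝[>] a).NeBot := inferInstance
  exact CompleteSpace.complete <| ((cauchy_nhds (a := a)).mono' hne inf_le_left).map_of_le
    hlip.uniformContinuousOn (le_principal_iff.2 (Ioo_mem_nhdsGT hac))

variable {𝕜 X Y : Type*} [RCLike 𝕜] [NormedAddCommGroup X] [NormedSpace 𝕜 X]
  [NormedAddCommGroup Y] [NormedSpace 𝕜 Y] {D : Submodule 𝕜 X}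
  {a b : D →ₗ[𝕜] Y} {n ν : ℕ} {S : CanonicalSystem a b n ν} {f : ℝ → D → Y}

theorem hasDerivWithinAt_clm_comp [NormedSpace ℝ Y] [IsScalarTower ℝ 𝕜 Y] (Q : Y →L[𝕜] Y) {s : Set ℝ}
    {g : ℝ → Y} {g' : Y} {t : ℝ} (h : HasDerivWithinAt g g' s t) :
    HasDerivWithinAt (fun τ => Q (g τ)) (Q g') s t :=
  (Q.restrictScalars ℝ).hasFDerivAt.comp_hasDerivWithinAt t h

/-- If `A y` converges in the part of `Y` complementary to the root vectors, and `y` is continuous,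
then `A y` converges: the remaining part of `y` lies in a finite-dimensional space, on which `A` is
bounded. The limit is identified by the closedness of `A`. -/
theorem tendsto_a_of_tendsto_Q1 (r : Reduction S f)
    (hgraph : IsClosed {p : X × Y | ∃ d : D, (d : X) = p.1 ∧ a d = p.2})
    {l : Filter ℝ} [l.NeBot] {y : ℝ → D} {x₀ : D} (hy : Tendsto y l (𝓝 x₀)) {z₀ : Y}
    (hz : Tendsto (fun t => S.Q1 (a (y t))) l (𝓝 z₀)) :
    Tendsto (fun t => a (y t)) l (𝓝 (a x₀)) := by
  have hP1 : ∀ x, S.P1 x = r.T (S.Q1 (a x)) := fun x => by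
    rw [← S.a_P1, r.T_a, S.P20_P1, sub_zero]
  set F : Submodule 𝕜 D := Submodule.span 𝕜
    (range fun p : (Σ i : Fin n, Fin (S.m i + 1)) => S.φ p.1 p.2) with hF
  have hFfin : FiniteDimensional 𝕜 F := FiniteDimensional.span_of_finite 𝕜 (Set.finite_range _)
  have hP2F : ∀ x, S.P2 x ∈ F := fun x => by
    rw [S.P2_apply]
    refine Submodule.sum_mem _ fun i _ => Submodule.sum_mem _ fun j hj =>
      Submodule.smul_mem _ _ (Submodule.subset_span ⟨⟨i, ⟨j, ?_⟩⟩, rfl⟩)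
    have := (Finset.mem_Icc.1 hj).2
    omega
  have hP2 : ∀ x, S.P2 x = x - S.P1 x := fun x => by simp [CanonicalSystem.P1]
  have h2 : Tendsto (fun t => S.P2 (y t)) l (𝓝 (x₀ - r.T z₀)) := by
    simp_rw [hP2, hP1]
    exact hy.sub ((r.T.continuous.tendsto _).comp hz)
  have hmem : x₀ - r.T z₀ ∈ F :=
    F.closed_of_finiteDimensional.mem_of_tendsto h2 (Eventually.of_forall fun t => hP2F _)
  have haF : Continuous (a ∘ₗ F.subtype) := LinearMap.continuous_of_finiteDimensional _
  have h3 : Tendsto (fun t => a (S.P2 (y t))) l (𝓝 (a (x₀ - r.T z₀))) := by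
    have h4 : Tendsto (fun t => (⟨S.P2 (y t), hP2F _⟩ : F)) l (𝓝 ⟨_, hmem⟩) :=
      tendsto_subtype_rng.2 h2
    exact (haF.tendsto _).comp h4
  have h5 : Tendsto (fun t => a (y t)) l (𝓝 (z₀ + a (x₀ - r.T z₀))) := by
    refine (hz.add h3).congr fun t => ?_
    rw [← S.a_P1, ← map_add, hP2, add_sub_cancel]
  have h6 : (((x₀ : X), z₀ + a (x₀ - r.T z₀)) : X × Y) ∈
      {p : X × Y | ∃ d : D, (d : X) = p.1 ∧ a d = p.2} :=
    hgraph.mem_of_tendsto (((continuous_subtype_val.tendsto _).comp hy).prodMk_nhds h5)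
      (Eventually.of_forall fun t => ⟨y t, rfl, rfl⟩)
  obtain ⟨d, hd, hd2⟩ := h6
  have : d = x₀ := Subtype.ext hd
  rw [this] at hd2
  change a x₀ = z₀ + a (x₀ - r.T z₀) at hd2
  rwa [← hd2] at h5

/-- `A y` is continuous at the initial time even when the equation is only known for later times:
the component of `A y` in `Y₁` solves a linear equation with bounded coefficients. -/
theorem tendsto_a_initial [NormedSpace ℝ Y] [IsScalarTower ℝ 𝕜 Y] [CompleteSpace Y]
    (r : Reduction S f)
    (hgraph : IsClosed {p : X × Y | ∃ d : D, (d : X) = p.1 ∧ a d = p.2})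
    (hf : ContinuousOn (fun p : ℝ × D => f p.1 p.2) (Set.Ici 0 ×ˢ Set.univ))
    {t₀ t₁ : ℝ} (ht₀ : 0 ≤ t₀) (h01 : t₀ < t₁) {y : ℝ → D} (hy : ContinuousOn y (Icc t₀ t₁))
    (hd : ∀ t ∈ Ioo t₀ t₁, HasDerivAt (fun s => a (y s)) (f t (y t) - b (y t)) t) :
    Tendsto (fun t => a (y t)) (𝓝[>] t₀) (𝓝 (a (y t₀))) := by
  have hg : ContinuousOn (fun t => S.Q1 (f t (y t))) (Icc t₀ t₁) :=
    S.Q1.continuous.comp_continuousOn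
      (hf.comp (f := fun t => (t, y t)) (continuousOn_id.prodMk hy)
        fun t ht => ⟨ht₀.trans ht.1, mem_univ _⟩)
  obtain ⟨C, hC⟩ := isCompact_Icc.exists_bound_of_continuousOn hg
  have hz : ∀ t ∈ Ioo t₀ t₁, HasDerivAt (fun s => S.Q1 (a (y s)))
      (S.Q1 (f t (y t)) - r.K (S.Q1 (a (y t)))) t := by
    intro t ht
    have h1 := hasDerivWithinAt_clm_comp S.Q1 (hd t ht).hasDerivWithinAt (s := univ)
    rw [hasDerivWithinAt_univ] at h1
    convert h1 using 1
    rw [map_sub, ← S.b_P1, r.K_apply, ← S.a_P1, r.T_a, S.P20_P1, sub_zero]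
  obtain ⟨l, hl⟩ := exists_tendsto_of_norm_deriv_le h01 (k := ‖r.K‖) (C := C) (norm_nonneg _)
    ((norm_nonneg _).trans (hC t₀ ⟨le_rfl, h01.le⟩)) hz fun t ht => by
      have h1 := norm_sub_le (S.Q1 (f t (y t))) (r.K (S.Q1 (a (y t))))
      have h2 := hC t ⟨ht.1.le, ht.2.le⟩
      have h3 := r.K.le_opNorm (S.Q1 (a (y t)))
      linarith
  refine tendsto_a_of_tendsto_Q1 r hgraph ?_ hl
  exact (hy t₀ ⟨le_rfl, h01.le⟩).mono_left <|
    nhdsWithin_le_iff.2 (mem_of_superset (Ioo_mem_nhdsGT h01) Ioo_subset_Icc_self)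

end Initial

/-! ### The initial value problem -/

section Main

variable {𝕜 X Y : Type*} [RCLike 𝕜] [NormedAddCommGroup X] [NormedSpace 𝕜 X]
  [NormedAddCommGroup Y] [NormedSpace 𝕜 Y] [NormedSpace ℝ Y] [IsScalarTower ℝ 𝕜 Y]
  {D : Submodule 𝕜 X}
  {a b : D →ₗ[𝕜] Y} {n ν : ℕ} {S : CanonicalSystem a b n ν} {f : ℝ → D → Y}

theorem hasDerivAt_coe {Z : Submodule 𝕜 Y} {u : ℝ → Z} {u' : Z} {t : ℝ} :
    HasDerivAt u u' t ↔ HasDerivAt (fun s => (u s : Y)) u' t := by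
  rw [hasDerivAt_iff_tendsto_slope, hasDerivAt_iff_tendsto_slope, tendsto_subtype_rng]
  rfl

/-- A solution of the reduced equation gives a solution of the original one. -/
theorem Reduction.isSolutionOn (r : Reduction S f)
    (hη : Continuous r.state) (hG : Continuous fun p : ℝ × S.W => r.G p.1 p.2) {t₀ : ℝ}
    (ht₀ : 0 ≤ t₀) {w : ℝ → S.W} (hw : ∀ t, t₀ ≤ t → HasDerivAt w (r.G t (w t)) t) :
    IsSolutionOn a b f (Ici t₀) fun t => r.state (t, w t) := by
  have hwc : ContinuousOn w (Ici t₀) := fun t ht => (hw t ht).continuousAt.continuousWithinAt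
  have hpc : ContinuousOn (fun t => (t, w t)) (Ici t₀) := continuousOn_id.prodMk hwc
  have hd : ∀ t, t₀ ≤ t → HasDerivAt (fun s => a (r.state (s, w s))) (r.G t (w t) : Y) t := by
    intro t ht
    have := hasDerivAt_coe.1 (hw t ht)
    simpa only [r.a_state] using this
  have hGc : ContinuousOn (fun t => (r.G t (w t) : Y)) (Ici t₀) :=
    continuous_subtype_val.comp_continuousOn (hG.comp_continuousOn hpc)
  unfold IsSolutionOn
  set J' : Set ℝ := if Ici t₀ = Ici (0 : ℝ) then Ioi 0 else Ici t₀ with hJ'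
  have hsub : J' ⊆ Ici t₀ := by
    rw [hJ']
    split_ifs with h
    · rw [h]; exact Ioi_subset_Ici_self
    · exact subset_rfl
  have hud : UniqueDiffOn ℝ J' := by
    rw [hJ']
    split_ifs
    · exact uniqueDiffOn_Ioi 0
    · exact uniqueDiffOn_Ici t₀
  have hdw : ∀ t ∈ J', derivWithin (fun s => a (r.state (s, w s))) J' t = r.G t (w t) :=
    fun t ht => (hd t (hsub ht)).hasDerivWithinAt.derivWithin (hud t ht)
  refine ⟨hη.comp_continuousOn hpc, ?_, fun t ht => ?_⟩
  · rw [contDiffOn_one_iff_derivWithin hud]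
    exact ⟨fun t ht => (hd t (hsub ht)).differentiableAt.differentiableWithinAt,
      (hGc.mono hsub).congr hdw⟩
  · rw [hdw t ht, r.coe_G, max_eq_left (ht₀.trans (hsub ht)), sub_add_cancel]

/-- Any solution on an interval with least element `t₀` comes from a solution of the reduced
equation. -/
theorem Reduction.rightSol_of_isSolutionOn [CompleteSpace Y] (r : Reduction S f)
    (hgraph : IsClosed {p : X × Y | ∃ d : D, (d : X) = p.1 ∧ a d = p.2})
    (hf : ContinuousOn (fun p : ℝ × D => f p.1 p.2) (Set.Ici 0 ×ˢ Set.univ))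
    (hG : Continuous fun p : ℝ × S.W => r.G p.1 p.2) {t₀ t₁ : ℝ}
    (ht₀ : 0 ≤ t₀) (h01 : t₀ < t₁) {J : Set ℝ} (hJ : J.OrdConnected) (hJ0 : IsLeast J t₀)
    (ht₁ : t₁ ∈ J) {y : ℝ → D} (hy : IsSolutionOn a b f J y) :
    RightSol r.G t₀ t₁ (fun t => ⟨a (y t), S.a_mem_W (y t)⟩) ∧ (t₁, y t₁) ∈ S.L0 f := by
  have : CompleteSpace S.W := S.isClosed_W.completeSpace_coe
  unfold IsSolutionOn at hy
  set J' : Set ℝ := if J = Ici (0 : ℝ) then Ioi 0 else J with hJ'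
  obtain ⟨hyc, hyd, hyeq⟩ := hy
  have hIcc : Icc t₀ t₁ ⊆ J := hJ.out hJ0.1 ht₁
  have hIoc : Ioc t₀ t₁ ⊆ J' := by
    intro t ht
    rw [hJ']
    split_ifs
    · exact ht₀.trans_lt ht.1
    · exact hIcc ⟨ht.1.le, ht.2⟩
  have hd : ∀ t ∈ Ioc t₀ t₁,
      HasDerivWithinAt (fun s => a (y s)) (f t (y t) - b (y t)) (Ioc t₀ t₁) t := by
    intro t ht
    have h1 := ((hyd.differentiableOn one_ne_zero) t (hIoc ht)).hasDerivWithinAt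
    rw [eq_sub_of_add_eq (hyeq t (hIoc ht))] at h1
    exact h1.mono hIoc
  have hd' : ∀ t ∈ Ioo t₀ t₁, HasDerivAt (fun s => a (y s)) (f t (y t) - b (y t)) t :=
    fun t ht => (hd t ⟨ht.1, ht.2.le⟩).hasDerivAt (Ioc_mem_nhds ht.1 ht.2)
  have hL0 : ∀ t ∈ Ioc t₀ t₁, (t, y t) ∈ S.L0 f := by
    intro t ht
    refine ⟨ht₀.trans ht.1.le, ?_⟩
    have h1 := hasDerivWithinAt_clm_comp S.Q2Star (hd t ht)
    simp only [S.Q2Star_a] at h1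
    exact (uniqueDiffOn_Ioc t₀ t₁ t ht).eq_deriv _ h1 (hasDerivWithinAt_const t _ (0 : Y))
  refine ⟨RightSol.of_Ioo hG ?_ fun t ht => ?_, hL0 t₁ ⟨h01, le_rfl⟩⟩
  · have hc : ContinuousOn (fun t => a (y t)) (Icc t₀ t₁) := by
      intro t ht
      rcases ht.1.eq_or_lt with rfl | h
      · have h1 := tendsto_a_initial r hgraph hf ht₀ h01 (hyc.mono hIcc) hd'
        exact (continuousWithinAt_Ioi_iff_Ici.1 h1).mono Icc_subset_Ici_self
      · refine (hd t ⟨h, ht.2⟩).continuousWithinAt.mono_of_mem_nhdsWithin ?_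
        rw [← Ioi_inter_Iic]
        exact inter_mem (mem_nhdsWithin_of_mem_nhds (Ioi_mem_nhds h))
          (mem_of_superset self_mem_nhdsWithin Icc_subset_Iic_self)
    exact fun t ht => tendsto_subtype_rng.2 (hc t ht)
  · have hL := hL0 t ⟨ht.1, ht.2.le⟩
    refine (hasDerivAt_coe.2 ?_).hasDerivWithinAt
    rw [r.coe_G, r.state_a hL.1 hL, max_eq_left hL.1]
    exact hd' t ht

end Main
end ADAE

end

theorem mainTheorem3 {𝕜 X Y : Type*} [RCLike 𝕜]
    [NormedAddCommGroup X] [NormedSpace 𝕜 X] [CompleteSpace X]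
    [NormedAddCommGroup Y] [NormedSpace 𝕜 Y] [CompleteSpace Y]
    [NormedSpace ℝ Y] [IsScalarTower ℝ 𝕜 Y]
    -- `A`, `B` are closed densely defined operators, `D = D_A ⊆ D_B`, `range A` is closed
    (A B : X →ₗ.[𝕜] Y) (hA : A.IsClosed) (hB : B.IsClosed)
    (hAdense : Dense (A.domain : Set X)) (hD : A.domain ≠ ⊥)
    (hAB : A.domain ≤ B.domain) (hrange : IsClosed (Set.range A.toFun))
    -- `f ∈ C(ℝ₊ × D, Y)`
    (f : ℝ → A.domain → Y)
    (hf : ContinuousOn (fun p : ℝ × A.domain => f p.1 p.2) (Set.Ici 0 ×ˢ Set.univ))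
    -- `λ A + B` is a regular pencil of index `ν`, `dim ker A = n < ∞`
    (n ν : ℕ)
    (hν : ADAE.HasPencilIndex A.toFun (B.toFun ∘ₗ Submodule.inclusion hAB) ν)
    (S : ADAE.CanonicalSystem A.toFun (B.toFun ∘ₗ Submodule.inclusion hAB) n ν)
    (h1 : S.UniqueConsistency f)
    (W : ℝ → A.domain → (S.D20 ≃L[𝕜] S.Y2Star))
    (h2 : S.LipschitzCondition f W ∨ S.SmoothCondition f W)
    (h3 : S.BoundednessCondition f W)
    (h4 : S.GrowthCondition f) :
    ∀ (t₀ : ℝ) (x₀ : A.domain), (t₀, x₀) ∈ S.L0 f →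
      ADAE.HasUniqueGlobalSolution A.toFun (B.toFun ∘ₗ Submodule.inclusion hAB) f t₀ x₀ := by
  intro t₀ x₀ hx₀
  have hW : S.ContractionCondition f W := h2.elim (fun h => h.contraction) fun h => h.contraction
  have hfl : ADAE.LocallyLipschitzInX f := h2.elim (fun h => h.1) fun h => h.locallyLipschitz
  obtain ⟨r⟩ := ADAE.exists_reduction A B hA hB hAB rfl rfl hrange hν.1 S h1
  have hgraph : IsClosed {p : X × Y | ∃ d : A.domain, (d : X) = p.1 ∧ A.toFun d = p.2} := by
    have h : (A.graph : Set (X × Y)) =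
        {p : X × Y | ∃ d : A.domain, (d : X) = p.1 ∧ A.toFun d = p.2} := by
      ext p
      exact LinearPMap.mem_graph_iff A
    rw [← h]
    exact hA
  have hG := r.continuous_G hf hW
  have hGl := r.locLipschitz_G hf hfl hW
  have ht₀ : 0 ≤ t₀ := hx₀.1
  obtain ⟨w, hw0, hw⟩ := r.exists_global_solution hf hfl hW h3 h4 ht₀
    ⟨A.toFun x₀, S.a_mem_W x₀⟩
  have hxt₀ : r.state (t₀, w t₀) = x₀ := by rw [hw0]; exact r.state_a ht₀ hx₀
  refine ⟨fun t => r.state (t, w t),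
    r.isSolutionOn (r.continuous_state hf hW) hG ht₀ hw, hxt₀, ?_⟩
  intro J hJ hJ0 y hy hy0 t₁ ht₁
  rcases (hJ0.2 ht₁).eq_or_lt with rfl | h01
  · exact hy0.trans hxt₀.symm
  obtain ⟨hsol, hL0⟩ := r.rightSol_of_isSolutionOn hgraph hf hG ht₀ h01 hJ hJ0 ht₁ hy
  have hwsol : ADAE.RightSol r.G t₀ t₁ w :=
    ⟨fun t ht => (hw t ht.1).continuousAt.continuousWithinAt,
      fun t ht => (hw t ht.1).hasDerivWithinAt⟩
  have heq := hsol.eqOn hGl hwsol (by rw [hw0]; exact Subtype.ext (congrArg A.toFun hy0))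
    (right_mem_Icc.2 h01.le)
  have hst := r.state_a (ht₀.trans h01.le) hL0
  change y t₁ = r.state (t₁, w t₁)
  rw [← heq]
  exact hst.symm
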